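/- Let $j\ge 1$, $\zeta=e^{2\pi i/j}$, and embed $\Gamma=\mathbb Z/j\mathbb Z$ in $\mathbf{SL}_3\mathbb C$ by $\gamma:\overline k\mapsto \mathrm{diag}(\zeta^k,1,\zeta^{-k})$. The irreducible representations of $\Gamma$ are, up to isomorphism and without repetition, the one-dimensional representations $\gamma_i$ with character $\overline k\mapsto\zeta^{ik}$, $0\le i\le j-1$. For $m,n\ge 0$ let $V(m,n)$ be the simple $\mathbf{SL}_3\mathbb C$-module of highest weight $m\varpi_1+n\varpi_2$, realized as the submodule of $\mathrm{Sym}^m(\mathbb C^3)\otimes \mathrm{Sym}^n((\mathbb C^3)^*)$ generated by the highest weight vector $e_1^{m}\otimes (e_3^*)^{n}$ (this module is finite-dimensional, algebraic, simple and of highest weight $m\varpi_1+n\varpi_2$). Let $m_i(m,n)$ be the multiplicity of $\gamma_i$ in $V(m,n)|_\Gamma$, and $P_\Gamma(t,u)_i=\sum_{m,n\ge0}m_i(m,n)t^mu^n\in\mathbb C[[t,u]]$. Then for $0\le i\le j-1$, in $\mathbb C[[t,u]]$, $$P_\Gamma(t,u)_i=\frac1j\sum_{p=0}^{j-1}\frac{\zeta^{ip}(1-tu)}{(1-t)(1-t\zeta^p)(1-t\zeta^{-p})(1-u)(1-u\zeta^p)(1-u\zeta^{-p})}.$$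 Let $A=(a_{ik})_{0\le i,k\le j-1}$ be defined by $\gamma_k\otimes\gamma=\bigoplus_i a_{ik}\gamma_i$. Put $C_\Gamma=2I-A-{}^tA+2\,\mathrm{Diag}(A)$, where $\mathrm{Diag}(A)$ is the diagonal part of $A$, and let $s_k$ be the matrix $(s_k)_{ab}=\delta_{ab}-(C_\Gamma)_{kb}\delta_{ak}$. If $j=2$, then $A=\begin{pmatrix}1&2\\2&1\end{pmatrix}$. If $j\ge3$, then $a_{ik}=1$ when $i-k\equiv 0,\pm1 \pmod j$ and $a_{ik}=0$ otherwise, and the graph of $C_\Gamma$ (two distinct vertices $k,l$ are joined when $(C_\Gamma)_{kl}\ne0$) is the cycle with vertices $0,1,\dots,j-1$ in this cyclic order. If $j$ is even, put $p=2$, $S_0=\{0,2,\dots,j-2\}$, $S_1=\{1,3,\dots,j-1\}$. If $j$ is odd, put $p=3$, $S_0=\{2,4,\dots,j-1\}$, $S_1=\{1,3,\dots,j-2\}$, $S_2=\{0\}$ (so $S_0=S_1=\emptyset$ if $j=1$). Then the sets $S_a$ form a partition of $\{0,\dots,j-1\}$ (empty parts allowed) into sets of mutually orthogonal indices, i.e.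 $(C_\Gamma)_{kl}=0$ for distinct $k,l$ in the same $S_a$; the reflections $s_k$, $k\in S_a$, commute; and with $\tau_a=\prod_{k\in S_a}s_k$, $$C_\Gamma=p\,I-\sum_{a=0}^{p-1}\tau_a .$$ If $j\ge2$, then $p$ is the least number of sets in such a partition into mutually orthogonal sets. -/

import Mathlib

open scoped BigOperators

noncomputable section

namespace McKayA1

/-! ### Simple modules of the special linear group of rank two -/

/-- The group of complex 3 x 3 matrices of determinant one. -/
abbrev SL3 : Type := Matrix.SpecialLinearGroup (Fin 3) ℂ

/-- The symmetric algebra of `E ⊕ E*`, where `E = ℂ³`: the variable `inl k` is the basis vector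
`e k` of `E`, and `inr k` is the dual basis vector `e* k`. Its part of bidegree `(m, n)` is
`Sym^m E ⊗ Sym^n E*`. -/
abbrev SymPoly : Type := MvPolynomial (Fin 3 ⊕ Fin 3) ℂ

/-- The action of `g` on `Sym (E ⊕ E*)` by algebra endomorphisms: `g (e k) = ∑ i, g i k • e i`,
and on `E*` the contragredient action `g (e* k) = e* k ∘ g⁻¹ = ∑ i, g⁻¹ k i • e* i`. -/
def symAct (g : SL3) : SymPoly →ₐ[ℂ] SymPoly :=
  MvPolynomial.aeval (Sum.elim
    (fun k => ∑ i, MvPolynomial.C (g.1 i k) * MvPolynomial.X (Sum.inl i))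
    (fun k => ∑ i, MvPolynomial.C ((g⁻¹).1 k i) * MvPolynomial.X (Sum.inr i)))

theorem symAct_inl (g : SL3) (k : Fin 3) :
    symAct g (MvPolynomial.X (Sum.inl k)) =
      ∑ i, MvPolynomial.C (g.1 i k) * MvPolynomial.X (Sum.inl i) := by
  simp [symAct]

theorem symAct_inr (g : SL3) (k : Fin 3) :
    symAct g (MvPolynomial.X (Sum.inr k)) =
      ∑ i, MvPolynomial.C ((g⁻¹).1 k i) * MvPolynomial.X (Sum.inr i) := by
  simp [symAct]

theorem symAct_C (g : SL3) (a : ℂ) :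
    symAct g (MvPolynomial.C a) = MvPolynomial.C a := by
  simp [symAct]

theorem symAct_one : symAct 1 = AlgHom.id ℂ SymPoly := by
  apply MvPolynomial.algHom_ext
  rintro (k | k)
  · rw [symAct_inl]; simp [Matrix.one_apply]
  · rw [symAct_inr]; simp [Matrix.one_apply]

theorem symAct_mul (g h : SL3) : symAct (g * h) = (symAct g).comp (symAct h) := by
  apply MvPolynomial.algHom_ext
  rintro (k | k)
  · rw [AlgHom.comp_apply, symAct_inl, symAct_inl]
    simp only [map_sum, map_mul, symAct_C, symAct_inl, Matrix.SpecialLinearGroup.coe_mul,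
      Matrix.mul_apply, Finset.sum_mul, Finset.mul_sum]
    rw [Finset.sum_comm]
    exact Finset.sum_congr rfl fun _ _ => Finset.sum_congr rfl fun _ _ => by ring
  · rw [AlgHom.comp_apply, symAct_inr, symAct_inr]
    simp only [map_sum, map_mul, symAct_C, symAct_inr, mul_inv_rev,
      Matrix.SpecialLinearGroup.coe_mul, Matrix.mul_apply, Finset.sum_mul, Finset.mul_sum]
    rw [Finset.sum_comm]
    exact Finset.sum_congr rfl fun _ _ => Finset.sum_congr rfl fun _ _ => by ring

/-- `Sym (E ⊕ E*)` as a representation of `SL₃(ℂ)`. -/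
def symRep : Representation ℂ SL3 SymPoly where
  toFun g := (symAct g).toLinearMap
  map_one' := by rw [symAct_one]; rfl
  map_mul' g h := by rw [symAct_mul]; rfl

/-- The vector `(e 0)^m ⊗ (e* 2)^n` of `Sym^m E ⊗ Sym^n E*`. -/
def hwVector (m n : ℕ) : SymPoly :=
  MvPolynomial.X (Sum.inl 0) ^ m * MvPolynomial.X (Sum.inr 2) ^ n

/-- `V(m ϖ₁ + n ϖ₂)`, realized as the submodule of `Sym^m E ⊗ Sym^n E*` generated by
`(e 0)^m ⊗ (e* 2)^n`. -/
def simpleSub (m n : ℕ) : Subrepresentation symRep where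
  toSubmodule := Submodule.span ℂ (Set.range fun g : SL3 => symRep g (hwVector m n))
  apply_mem_toSubmodule g v hv := by
    induction hv using Submodule.span_induction with
    | mem x hx =>
      obtain ⟨h, rfl⟩ := hx
      exact Submodule.subset_span ⟨g * h, by simp⟩
    | zero => simp
    | add x y _ _ hx hy => rw [map_add]; exact Submodule.add_mem _ hx hy
    | smul a x _ hx => rw [map_smul]; exact Submodule.smul_mem _ a hx

/-- The representation `π_{m,n}` of `SL₃(ℂ)` on `V(m ϖ₁ + n ϖ₂)`. -/
def simpleRep (m n : ℕ) : Representation ℂ SL3 (simpleSub m n).toSubmodule :=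
  (simpleSub m n).toRepresentation

/-- `ρ` is a simple finite-dimensional algebraic representation of `SL₃(ℂ)` of highest weight
`m ϖ₁ + n ϖ₂`: some nonzero vector spans a line stable under the upper triangular group, which
acts on it by the character `b ↦ (b 0 0)^m * (b 0 0 * b 1 1)^n`. -/
structure IsSimpleOfHighestWeight {V : Type*} [AddCommGroup V] [Module ℂ V]
    (ρ : Representation ℂ SL3 V) (m n : ℕ) : Prop where
  finiteDimensional : FiniteDimensional ℂ V
  algebraic : ∀ (v : V) (φ : Module.Dual ℂ V), ∃ p : MvPolynomial (Fin 3 × Fin 3) ℂ,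
    ∀ g : SL3, φ (ρ g v) = MvPolynomial.eval (fun x => g.1 x.1 x.2) p
  irreducible : ρ.IsIrreducible
  highestWeight : ∃ v : V, v ≠ 0 ∧ ∀ b : SL3, (∀ i k : Fin 3, k < i → b.1 i k = 0) →
    ρ b v = (b.1 0 0 ^ m * (b.1 0 0 * b.1 1 1) ^ n) • v

/-- The natural representation of `SL₃(ℂ)` on `ℂ³`. -/
def naturalRep : Representation ℂ SL3 (Fin 3 → ℂ) where
  toFun g := g.1.mulVecLin
  map_one' := by ext; simp
  map_mul' g h := by
    rw [Matrix.SpecialLinearGroup.coe_mul, Matrix.mulVecLin_mul]; rfl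

/-! ### Multiplicities -/

/-- The multiplicity of the irreducible representation `σ` in `ρ` (representations of a finite
group on finite-dimensional complex vector spaces): the dimension of `Hom_G(σ, ρ)`. -/
def multiplicity {G W V : Type*} [Group G] [AddCommGroup W] [Module ℂ W]
    [AddCommGroup V] [Module ℂ V] (σ : Representation ℂ G W) (ρ : Representation ℂ G V) : ℕ :=
  Module.finrank ℂ (Representation.IntertwiningMap σ ρ)

/-! ### The cyclic group -/

/-- `ζ_j = exp(2πi/j)`. -/
def zeta (j : ℕ) : ℂ := Complex.exp (2 * Real.pi * Complex.I / j)

theorem zeta_ne_zero (j : ℕ) : zeta j ≠ 0 := Complex.exp_ne_zero _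

theorem zeta_pow_self (j : ℕ) [NeZero j] : zeta j ^ j = 1 :=
  (Complex.isPrimitiveRoot_exp j (NeZero.ne j)).pow_eq_one

theorem zeta_pow_mod (j : ℕ) [NeZero j] (a : ℕ) : zeta j ^ (a % j) = zeta j ^ a := by
  conv_rhs => rw [← Nat.mod_add_div a j, pow_add, pow_mul, zeta_pow_self, one_pow, mul_one]

theorem zeta_pow_val_add (j : ℕ) [NeZero j] (a b : ZMod j) :
    zeta j ^ (a + b).val = zeta j ^ a.val * zeta j ^ b.val := by
  rw [ZMod.val_add, zeta_pow_mod, pow_add]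

/-- `Γ = ℤ/jℤ`, written multiplicatively. -/
abbrev Gam (j : ℕ) : Type := Multiplicative (ZMod j)

/-- The embedding `γ : ℤ/jℤ → SL₃(ℂ)`, `k ↦ diag(ζ^k, 1, ζ^{-k})`. -/
def gammaHom (j : ℕ) [NeZero j] : Gam j →* SL3 where
  toFun k := ⟨Matrix.diagonal ![zeta j ^ (k.toAdd).val, 1, (zeta j ^ (k.toAdd).val)⁻¹], by
    rw [Matrix.det_diagonal, Fin.prod_univ_three]
    simp [zeta_ne_zero]⟩
  map_one' := by
    apply Subtype.ext
    ext a b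
    fin_cases a <;> fin_cases b <;> simp
  map_mul' k l := by
    apply Subtype.ext
    change Matrix.diagonal _ = Matrix.diagonal _ * Matrix.diagonal _
    rw [Matrix.diagonal_mul_diagonal, toAdd_mul, zeta_pow_val_add, mul_inv]
    congr 1
    ext a
    fin_cases a <;> simp

/-- The one-dimensional representation `γ_i` of `ℤ/jℤ`, with character `k ↦ ζ^{ik}`. -/
def irr (j : ℕ) [NeZero j] (i : Fin j) : Representation ℂ (Gam j) ℂ where
  toFun k := (zeta j ^ (i.val * (k.toAdd).val)) • LinearMap.id
  map_one' := by simp; rfl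
  map_mul' k l := by
    rw [toAdd_mul, mul_comm i.val, pow_mul, zeta_pow_val_add]
    ext
    simp [mul_pow, ← pow_mul, mul_comm]

/-- `m_i(m, n)`: the multiplicity of `γ_i` in the restriction of `π_{m,n}` to `ℤ/jℤ`. -/
def branchMult (j : ℕ) [NeZero j] (i : Fin j) (m n : ℕ) : ℕ :=
  multiplicity (irr j i) ((simpleRep m n).comp (gammaHom j))

/-- `P_Γ(t, u)_i = ∑_{m,n} m_i(m, n) t^m u^n` in `ℂ[[t, u]]`; variable `0` is `t` and variable
`1` is `u`. -/
def branchSeries (j : ℕ) [NeZero j] (i : Fin j) : MvPowerSeries (Fin 2) ℂ :=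
  fun d => (branchMult j i (d 0) (d 1) : ℂ)

/-- The denominator `(1-t)(1-tζ^p)(1-tζ^{-p})(1-u)(1-uζ^p)(1-uζ^{-p})`, with `z = ζ^p`. Its
constant coefficient is `1`, so it is invertible in `ℂ[[t, u]]`. -/
def denom (z : ℂ) : MvPowerSeries (Fin 2) ℂ :=
  (1 - MvPowerSeries.X 0) * (1 - MvPowerSeries.X 0 * MvPowerSeries.C z) *
    (1 - MvPowerSeries.X 0 * MvPowerSeries.C z⁻¹) *
  ((1 - MvPowerSeries.X 1) * (1 - MvPowerSeries.X 1 * MvPowerSeries.C z) *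
    (1 - MvPowerSeries.X 1 * MvPowerSeries.C z⁻¹))

/-! ### The generalized Cartan matrix -/

/-- The matrix `A⁽¹⁾`: its `(i, k)` entry is the multiplicity of `γ_i` in `γ_k ⊗ γ`, where `γ` is
the natural three-dimensional representation of `ℤ/jℤ`. -/
def mcKayMatrix (j : ℕ) [NeZero j] : Matrix (Fin j) (Fin j) ℤ :=
  Matrix.of fun i k =>
    (multiplicity (irr j i) ((irr j k).tprod (naturalRep.comp (gammaHom j))) : ℤ)

/-- `C_Γ = 2 I - A⁽¹⁾ - ᵗA⁽¹⁾ + 2 Diag(A⁽¹⁾)`. -/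
def cartan (j : ℕ) [NeZero j] : Matrix (Fin j) (Fin j) ℤ :=
  (2 : ℤ) • (1 : Matrix (Fin j) (Fin j) ℤ) - mcKayMatrix j - (mcKayMatrix j).transpose
    + (2 : ℤ) • Matrix.diagonal (mcKayMatrix j).diag

/-- The simple reflection `s_k` attached to `C`: `(s_k)_{ab} = δ_{ab} - C_{kb} δ_{ak}`. -/
def reflection {j : ℕ} (C : Matrix (Fin j) (Fin j) ℤ) (k : Fin j) :
    Matrix (Fin j) (Fin j) ℤ :=
  Matrix.of fun a b => (if a = b then 1 else 0) - (if a = k then C k b else 0)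

/-- The product of the reflections `s_k`, `k ∈ S`, in increasing order of `k`. -/
def reflectionProd {j : ℕ} (C : Matrix (Fin j) (Fin j) ℤ) (S : Finset (Fin j)) :
    Matrix (Fin j) (Fin j) ℤ :=
  ((S.sort (· ≤ ·)).map (reflection C)).prod

/-- The sets `S 0, …, S (p - 1)` partition the indices of the simple roots (parts may be empty)
into sets of mutually orthogonal roots. -/
def IsOrthogonalPartition {j : ℕ} (C : Matrix (Fin j) (Fin j) ℤ) (p : ℕ)
    (S : Fin p → Finset (Fin j)) : Prop :=
  (∀ a b, a ≠ b → Disjoint (S a) (S b)) ∧ (∀ k, ∃ a, k ∈ S a) ∧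
    ∀ a, ∀ k ∈ S a, ∀ l ∈ S a, k ≠ l → C k l = 0

/-- The sets of indices of the reflections occurring in `τ₀, τ₁` for even `j`:
`{0, 2, …, j-2}` and `{1, 3, …, j-1}`. -/
def partsEven (j : ℕ) : Fin 2 → Finset (Fin j) :=
  ![Finset.univ.filter fun k => Even k.val, Finset.univ.filter fun k => Odd k.val]

/-- The sets of indices of the reflections occurring in `τ₀, τ₁, τ₂` for odd `j`:
`{2, 4, …, j-1}`, `{1, 3, …, j-2}` and `{0}`. -/
def partsOdd (j : ℕ) : Fin 3 → Finset (Fin j) :=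
  ![Finset.univ.filter fun k => Even k.val ∧ k.val ≠ 0, Finset.univ.filter fun k => Odd k.val,
    Finset.univ.filter fun k => k.val = 0]

/-- The graph of `C`: distinct vertices `k, l` are joined when `C k l ≠ 0` or `C l k ≠ 0`. -/
def cartanGraph {j : ℕ} (C : Matrix (Fin j) (Fin j) ℤ) : SimpleGraph (Fin j) :=
  SimpleGraph.fromRel fun k l => C k l ≠ 0

end McKayA1

end

/-!
The module `Sym^m E ⊗ Sym^n E*` is the space of polynomials of bidegree `(m, n)` in a vector and a
covector. A translate of the highest weight vector is a product `ℓ^m f^n`, with `ℓ` the first column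
of `g` and `f` the third row of `g⁻¹`, so that `f ℓ = 0`. For the Fischer inner product, pairing with
`ℓ^m f^n` is, up to a positive factor, evaluation at the conjugate point (`fischer_linPow`). Hence
the orthogonal complement of `V(m, n)` consists of the polynomials vanishing on all incident pairs,
and by the Nullstellensatz these are the multiples of the prime invariant form `q = ∑ e k ⊗ e* k`
(`incidence_dvd_of_eval_flagPoint`, `forall_fischer_eq_zero_iff`). As the inner product is positive
definite, `Sym^m E ⊗ Sym^n E* = V(m, n) ⊕ q (Sym^(m-1) E ⊗ Sym^(n-1) E*)`.

This decomposition gives both statements on `V(m, n)`. A nonzero element of an invariant subspace is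
not a multiple of `q`, so it does not vanish at some flag; this means that some translate of it
involves the highest weight vector, which an element of the torus then isolates
(`simpleSub_le_of_invariant`). And the multiplicity of `γ_i` in `V(m, n)` is the difference of two
numbers of monomials (`branchMult_add`). The generating series of the characters of
`Sym^m E ⊗ Sym^n E*` at `diag(z, 1, z⁻¹)` is a product of six geometric series, the inverse of
`denom z` (`denom_inv`); the factor `1 - t u` accounts for the summand divisible by `q`, and averaging
over the roots of unity selects the monomials on which `ℤ/jℤ` acts through `γ_i`.

The McKay matrix is computed in a basis of eigenvectors. A product of reflections in mutually
orthogonal roots differs from the identity only in the rows of these roots, where it agrees with the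
reflections (`prod_map_reflection_apply`); summing over the parts of a partition gives the
decomposition of the Cartan matrix. Partitions into orthogonal parts are colourings of a cycle, whose
chromatic number gives the minimal number of parts.
-/

open scoped BigOperators

noncomputable section

namespace McKayA1

/-! ### Representations of the cyclic group -/

theorem isPrimitiveRoot_zeta (j : ℕ) [NeZero j] : IsPrimitiveRoot (zeta j) j :=
  Complex.isPrimitiveRoot_exp j (NeZero.ne j)

theorem zeta_pow_one_val (j : ℕ) [NeZero j] : zeta j ^ (1 : ZMod j).val = zeta j := by
  rw [ZMod.val_one_eq_one_mod, zeta_pow_mod, pow_one]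

theorem ofAdd_eq_pow (j : ℕ) [NeZero j] (g : Gam j) :
    g = (Multiplicative.ofAdd (1 : ZMod j)) ^ (g.toAdd).val := by
  rw [← ofAdd_nsmul, nsmul_one, ZMod.natCast_zmod_val, ofAdd_toAdd]

/-- An eigenvector of the generator of `ℤ/jℤ` with eigenvalue `ζ^i` transforms under the
whole group by the character of `γ_i`. -/
theorem apply_of_mem_eigenspace {j : ℕ} [NeZero j] {V : Type*} [AddCommGroup V] [Module ℂ V]
    (ρ : Representation ℂ (Gam j) V) (i : ℕ) {v : V}
    (hv : v ∈ Module.End.eigenspace (ρ (Multiplicative.ofAdd 1)) (zeta j ^ i)) (g : Gam j) :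
    ρ g v = zeta j ^ (i * (g.toAdd).val) • v := by
  rw [Module.End.mem_eigenspace_iff] at hv
  conv_lhs => rw [ofAdd_eq_pow j g]
  rw [map_pow]
  induction (g.toAdd).val with
  | zero => simp
  | succ n ih => rw [pow_succ, Module.End.mul_apply, hv, map_smul, ih, smul_smul]; congr 1; ring

theorem irr_apply (j : ℕ) [NeZero j] (i : Fin j) (g : Gam j) (x : ℂ) :
    irr j i g x = zeta j ^ (i.val * (g.toAdd).val) * x := rfl

theorem irr_generator_apply (j : ℕ) [NeZero j] (i : Fin j) (x : ℂ) :
    irr j i (Multiplicative.ofAdd 1) x = zeta j ^ i.val * x := by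
  rw [irr_apply, toAdd_ofAdd, mul_comm i.val, pow_mul, zeta_pow_one_val]

/-- An intertwining map out of `γ_i` is determined by the image of `1`, which may be any
eigenvector of the generator with eigenvalue `ζ^i`. -/
theorem multiplicity_irr {j : ℕ} [NeZero j] (i : Fin j) {V : Type*} [AddCommGroup V] [Module ℂ V]
    (ρ : Representation ℂ (Gam j) V) :
    multiplicity (irr j i) ρ =
      Module.finrank ℂ (Module.End.eigenspace (ρ (Multiplicative.ofAdd 1)) (zeta j ^ i.val)) := by
  refine LinearEquiv.finrank_eq
    { toFun := fun f => ⟨f 1, ?_⟩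
      map_add' := fun f g => rfl
      map_smul' := fun a f => rfl
      invFun := fun v => ⟨LinearMap.toSpanSingleton ℂ V v.1, ?_⟩
      left_inv := ?_
      right_inv := ?_ }
  · rw [Module.End.mem_eigenspace_iff]
    have h := Representation.IntertwiningMap.isIntertwining _ _ f (Multiplicative.ofAdd 1) (1 : ℂ)
    rw [irr_generator_apply, ← smul_eq_mul, map_smul] at h
    exact h.symm
  · intro g
    ext
    have := apply_of_mem_eigenspace ρ i.val v.2 g
    simp [irr_apply, this]
  · intro f
    apply Representation.IntertwiningMap.ext
    ext
    simp
  · intro v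
    ext
    simp

theorem irr_isIrreducible (j : ℕ) [NeZero j] (i : Fin j) : (irr j i).IsIrreducible := by
  refine { exists_pair_ne := ⟨⊥, ⊤, ?_⟩, eq_bot_or_eq_top := fun W => ?_ }
  · intro h
    have := congrArg Subrepresentation.toSubmodule h
    exact bot_ne_top (α := Submodule ℂ ℂ) this
  · rcases eq_bot_or_eq_top W.toSubmodule with h | h
    · exact Or.inl (Subrepresentation.toSubmodule_injective h)
    · exact Or.inr (Subrepresentation.toSubmodule_injective h)

theorem irr_injective (j : ℕ) [NeZero j] (i k : Fin j)
    (h : Nonempty ((irr j i).Equiv (irr j k))) : i = k := by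
  obtain ⟨e⟩ := h
  have h := Representation.IntertwiningMap.isIntertwining _ _ e.toIntertwiningMap
    (Multiplicative.ofAdd 1) (1 : ℂ)
  rw [irr_generator_apply, irr_generator_apply, ← smul_eq_mul, map_smul, smul_eq_mul] at h
  have h1 : e.toIntertwiningMap (1 : ℂ) ≠ 0 := fun h0 =>
    one_ne_zero (e.toLinearEquiv.map_eq_zero_iff.mp h0)
  exact Fin.ext ((isPrimitiveRoot_zeta j).pow_inj i.2 k.2 (mul_right_cancel₀ h1 h))

theorem exists_equiv_irr (j : ℕ) [NeZero j] {W : Type*} [AddCommGroup W] [Module ℂ W]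
    [FiniteDimensional ℂ W] (σ : Representation ℂ (Gam j) W) (hσ : σ.IsIrreducible) :
    ∃ i : Fin j, Nonempty (σ.Equiv (irr j i)) := by
  have h1 : Module.finrank ℂ W = 1 :=
    Representation.IsIrreducible.finrank_eq_one_of_isMulCommutative σ
  have : Nontrivial W := Module.nontrivial_of_finrank_pos (R := ℂ) (by omega)
  obtain ⟨μ, hμ⟩ := Module.End.exists_eigenvalue (σ (Multiplicative.ofAdd 1))
  obtain ⟨v, hv⟩ := hμ.exists_hasEigenvector
  have hroot : μ ^ j = 1 := by
    have h2 := hv.pow_apply j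
    rw [← map_pow, ← ofAdd_nsmul, nsmul_one, ZMod.natCast_self, ofAdd_zero, map_one,
      Module.End.one_apply] at h2
    have h3 : (μ ^ j - 1) • v = 0 := by rw [sub_smul, ← h2, one_smul, sub_self]
    exact sub_eq_zero.mp ((smul_eq_zero.mp h3).resolve_right hv.2)
  obtain ⟨i, hi, rfl⟩ := (isPrimitiveRoot_zeta j).eq_pow_of_pow_eq_one hroot
  refine ⟨⟨i, hi⟩, ⟨Representation.Equiv.symm ?_⟩⟩
  refine Representation.Equiv.mk (LinearEquiv.toSpanNonzeroSingleton ℂ W v hv.2 |>.trans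
    (LinearEquiv.ofTop _ ((finrank_eq_one_iff_of_nonzero v hv.2).mp h1))) fun g => ?_
  ext
  have := apply_of_mem_eigenspace σ i hv.1 g
  simp [irr_apply, this]

theorem gammaHom_injective (j : ℕ) [NeZero j] : Function.Injective (gammaHom j) := by
  intro a b h
  have h1 : (gammaHom j a).1 0 0 = (gammaHom j b).1 0 0 := by rw [h]
  have h2 := (isPrimitiveRoot_zeta j).pow_inj (ZMod.val_lt _) (ZMod.val_lt _)
    (show zeta j ^ (a.toAdd).val = zeta j ^ (b.toAdd).val from h1)
  exact Multiplicative.toAdd.injective (ZMod.val_injective j h2)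

/-- The eigenspaces of an operator which is diagonal in a basis. -/
theorem finrank_eigenspace_of_basis {ι V : Type*} [Fintype ι] [AddCommGroup V] [Module ℂ V]
    (b : Module.Basis ι ℂ V) (f : Module.End ℂ V) (c : ι → ℂ) (hf : ∀ l, f (b l) = c l • b l)
    (μ : ℂ) : Module.finrank ℂ (Module.End.eigenspace f μ) = ∑ l, if c l = μ then 1 else 0 := by
  classical
  have hrepr : ∀ v l, b.repr (f v) l = c l * b.repr v l := by
    intro v l
    conv_lhs => rw [← b.sum_repr v]
    rw [map_sum, map_sum, Finsupp.finsetSum_apply]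
    simp [hf, Finsupp.single_apply, mul_comm]
  have h : Module.End.eigenspace f μ = Submodule.span ℂ (b '' {l | c l = μ}) := by
    ext v
    rw [Module.End.mem_eigenspace_iff, Module.Basis.mem_span_image]
    constructor
    · intro hv l hl
      have h1 := hrepr v l
      rw [hv, map_smul, Finsupp.smul_apply, smul_eq_mul] at h1
      exact (mul_right_cancel₀ (Finsupp.mem_support_iff.mp hl) h1).symm
    · intro hv
      apply b.ext_elem
      intro l
      rw [hrepr, map_smul, Finsupp.smul_apply, smul_eq_mul]
      by_cases hl : b.repr v l = 0
      · rw [hl, mul_zero, mul_zero]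
      · rw [show c l = μ from hv (Finsupp.mem_support_iff.mpr hl)]
  rw [h, ← Finset.card_filter]
  have hli : LinearIndependent ℂ fun x : {l | c l = μ} => b x :=
    b.linearIndependent.comp _ Subtype.val_injective
  have := finrank_span_eq_card hli
  rw [Set.image_eq_range, this, Fintype.card_subtype]
  rfl

/-! ### The generalized Cartan matrix -/

theorem zeta_pow_val_succ (j : ℕ) [NeZero j] (k : Fin j) :
    zeta j ^ (k + 1).val = zeta j ^ k.val * zeta j := by
  rw [Fin.val_add, zeta_pow_mod, pow_add, Fin.val_one', zeta_pow_mod, pow_one]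

theorem zeta_pow_val_inj {j : ℕ} [NeZero j] {i k : Fin j} :
    zeta j ^ i.val = zeta j ^ k.val ↔ i = k :=
  ⟨fun h => Fin.ext ((isPrimitiveRoot_zeta j).pow_inj i.2 k.2 h), fun h => by rw [h]⟩

theorem mcKayMatrix_apply (j : ℕ) [NeZero j] (i k : Fin j) :
    mcKayMatrix j i k =
      (if i = k + 1 then 1 else 0) + (if i = k then 1 else 0) + (if k = i + 1 then 1 else 0) := by
  have hz := zeta_ne_zero j
  let b : Module.Basis (Unit × Fin 3) ℂ (TensorProduct ℂ ℂ (Fin 3 → ℂ)) :=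
    (Module.Basis.singleton Unit ℂ).tensorProduct (Pi.basisFun ℂ (Fin 3))
  have h := finrank_eigenspace_of_basis b
    (((irr j k).tprod (naturalRep.comp (gammaHom j))) (Multiplicative.ofAdd 1))
    (fun l => zeta j ^ k.val * (![zeta j, 1, (zeta j)⁻¹] : Fin 3 → ℂ) l.2) (by
      rintro ⟨u, l⟩
      have h1 : ((naturalRep.comp (gammaHom j)) (Multiplicative.ofAdd 1)) (Pi.single l 1) =
          (![zeta j, 1, (zeta j)⁻¹] : Fin 3 → ℂ) l • (Pi.single l 1 : Fin 3 → ℂ) := by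
        change Matrix.mulVec (Matrix.diagonal _) _ = _
        rw [Matrix.diagonal_mulVec_single, toAdd_ofAdd, zeta_pow_one_val, ← Pi.single_smul',
          smul_eq_mul]
      simp only [b, Module.Basis.tensorProduct_apply, Representation.tprod_apply,
        TensorProduct.map_tmul, Module.Basis.singleton_apply, Pi.basisFun_apply]
      rw [h1, irr_generator_apply, mul_one, TensorProduct.tmul_smul,
        ← mul_one (zeta j ^ k.val), ← smul_eq_mul, ← TensorProduct.smul_tmul', smul_smul, mul_comm,
        smul_eq_mul, mul_one])
    (zeta j ^ i.val)
  simp only [mcKayMatrix, Matrix.of_apply]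
  rw [multiplicity_irr, h]
  have e0 : zeta j ^ k.val * zeta j = zeta j ^ i.val ↔ i = k + 1 := by
    rw [← zeta_pow_val_succ, zeta_pow_val_inj, eq_comm]
  have e1 : zeta j ^ k.val = zeta j ^ i.val ↔ i = k := by rw [zeta_pow_val_inj, eq_comm]
  have e2 : zeta j ^ k.val * (zeta j)⁻¹ = zeta j ^ i.val ↔ k = i + 1 := by
    rw [← div_eq_mul_inv, div_eq_iff hz, ← zeta_pow_val_succ, zeta_pow_val_inj]
  rw [Fintype.sum_prod_type]
  simp only [Fin.sum_univ_three, Finset.univ_unique, Finset.sum_singleton]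
  simp [e0, e1, e2]

theorem cartan_apply (j : ℕ) [NeZero j] (k l : Fin j) :
    cartan j k l = if k = l then 2 else
      -2 * ((if k = l + 1 then 1 else 0) + (if l = k + 1 then 1 else 0)) := by
  simp only [cartan, Matrix.add_apply, Matrix.sub_apply, Matrix.smul_apply, Matrix.transpose_apply,
    Matrix.one_apply, Matrix.diagonal_apply, Matrix.diag_apply, smul_eq_mul]
  by_cases h : k = l
  · subst h
    simp only [if_true]
    ring
  · simp only [if_neg h]
    rw [mcKayMatrix_apply, mcKayMatrix_apply, if_neg h, if_neg (Ne.symm h)]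
    ring

theorem cartan_eq_zero_iff {j : ℕ} [NeZero j] {k l : Fin j} (h : k ≠ l) :
    cartan j k l = 0 ↔ ¬(k = l + 1 ∨ l = k + 1) := by
  rw [cartan_apply, if_neg h]
  split_ifs with h1 h2 h2
  · exact iff_of_false (by norm_num) (not_not.mpr (Or.inl h1))
  · exact iff_of_false (by norm_num) (not_not.mpr (Or.inl h1))
  · exact iff_of_false (by norm_num) (not_not.mpr (Or.inr h2))
  · exact iff_of_true (by norm_num) (not_or.mpr ⟨h1, h2⟩)

theorem fin_val_of_eq_add_one {j : ℕ} [NeZero j] {k l : Fin j} (h : k = l + 1) :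
    k.val = l.val + 1 ∨ (l.val + 1 = j ∧ k.val = 0) := by
  have h1 : k.val = (l.val + 1) % j := by rw [h, Fin.val_add, Fin.val_one', Nat.add_mod_mod]
  rcases Nat.lt_or_ge (l.val + 1) j with h2 | h2
  · left; rw [h1, Nat.mod_eq_of_lt h2]
  · right
    have h3 : l.val + 1 = j := by have := l.2; omega
    exact ⟨h3, by rw [h1, h3, Nat.mod_self]⟩

/-- The product of reflections in mutually orthogonal roots differs from the identity only in
the rows indexed by those roots, where it agrees with the corresponding reflections. -/
theorem prod_map_reflection_apply {j : ℕ} (C : Matrix (Fin j) (Fin j) ℤ) (L : List (Fin j))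
    (hL : L.Nodup) (hC : ∀ k ∈ L, ∀ l ∈ L, k ≠ l → C k l = 0) (a b : Fin j) :
    (L.map (reflection C)).prod a b = (if a = b then 1 else 0) - (if a ∈ L then C a b else 0) := by
  induction L generalizing a b with
  | nil => simp [Matrix.one_apply]
  | cons k L ih =>
    have ih' := ih hL.of_cons fun x hx y hy => hC x (by simp [hx]) y (by simp [hy])
    have hk : k ∉ L := (List.nodup_cons.mp hL).1
    have hsum : ∑ c, C k c * ((if c = b then 1 else 0) - (if c ∈ L then C c b else 0)) = C k b := by
      have : ∀ c, C k c * ((if c = b then 1 else 0) - (if c ∈ L then C c b else 0)) =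
          if c = b then C k c else 0 := by
        intro c
        by_cases hc : c ∈ L
        · have h0 : C k c = 0 := hC k (by simp) c (by simp [hc]) fun h => hk (h ▸ hc)
          simp [h0]
        · simp [hc]
      simp [this]
    rw [List.map_cons, List.prod_cons, Matrix.mul_apply]
    simp only [reflection, Matrix.of_apply, sub_mul, Finset.sum_sub_distrib] at ih' ⊢
    simp only [ih', ite_mul, one_mul, zero_mul, Finset.sum_ite_eq, Finset.mem_univ, if_true]
    by_cases hak : a = k
    · subst hak
      simp [hsum, hk]
    · simp [hak]

theorem reflection_commute {j : ℕ} (C : Matrix (Fin j) (Fin j) ℤ) {k l : Fin j}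
    (h : k ≠ l → C k l = 0 ∧ C l k = 0) : Commute (reflection C k) (reflection C l) := by
  rcases eq_or_ne k l with rfl | hkl
  · exact Commute.refl _
  · obtain ⟨h1, h2⟩ := h hkl
    have e1 := prod_map_reflection_apply C [k, l] (by simpa using hkl) (by simp [h1, h2])
    have e2 := prod_map_reflection_apply C [l, k] (by simpa using hkl.symm) (by simp [h1, h2])
    ext a b
    have e1 := e1 a b
    have e2 := e2 a b
    simp only [List.map_cons, List.map_nil, List.prod_cons, List.prod_nil, mul_one,
      List.mem_cons, List.not_mem_nil, or_false] at e1 e2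
    rw [e1, e2]
    simp [or_comm]

theorem IsOrthogonalPartition.commute {j p : ℕ} {C : Matrix (Fin j) (Fin j) ℤ}
    {S : Fin p → Finset (Fin j)} (h : IsOrthogonalPartition C p S) (a : Fin p) (k : Fin j)
    (hk : k ∈ S a) (l : Fin j) (hl : l ∈ S a) : Commute (reflection C k) (reflection C l) :=
  reflection_commute C fun hkl => ⟨h.2.2 a k hk l hl hkl, h.2.2 a l hl k hk hkl.symm⟩

theorem IsOrthogonalPartition.eq_sub_sum {j p : ℕ} {C : Matrix (Fin j) (Fin j) ℤ}
    {S : Fin p → Finset (Fin j)} (h : IsOrthogonalPartition C p S) :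
    C = (p : ℤ) • (1 : Matrix (Fin j) (Fin j) ℤ) - ∑ a, reflectionProd C (S a) := by
  ext k l
  have h1 : ∀ a, reflectionProd C (S a) k l =
      (if k = l then 1 else 0) - (if k ∈ S a then C k l else 0) := by
    intro a
    rw [reflectionProd, prod_map_reflection_apply C _ (Finset.sort_nodup _ _)]
    · simp
    · simpa using h.2.2 a
  obtain ⟨a, ha⟩ := h.2.1 k
  have h2 : ∑ b, (if k ∈ S b then C k l else 0) = C k l := by
    rw [Finset.sum_eq_single a]
    · simp [ha]
    · intro b _ hb
      have := Finset.disjoint_left.mp (h.1 a b hb.symm) ha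
      simp [this]
    · simp
  rw [Matrix.sub_apply, Matrix.sum_apply, Matrix.smul_apply, Matrix.one_apply]
  simp only [h1, Finset.sum_sub_distrib, h2]
  simp

theorem isOrthogonalPartition_even (j : ℕ) [NeZero j] (hj : Even j) :
    IsOrthogonalPartition (cartan j) 2 (partsEven j) := by
  refine ⟨?_, ?_, ?_⟩
  · intro a b hab
    rw [Finset.disjoint_left]
    intro k
    fin_cases a <;> fin_cases b <;> simp_all [partsEven]
  · intro k
    rcases Nat.even_or_odd k.val with h | h
    · exact ⟨0, by simp [partsEven, h]⟩
    · exact ⟨1, by simp [partsEven, h]⟩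
  · intro a k hk l hl hkl
    rw [cartan_eq_zero_iff hkl]
    have hpar : k.val % 2 = l.val % 2 := by
      fin_cases a <;> simp [partsEven, Nat.even_iff, Nat.odd_iff] at hk hl <;> omega
    rw [Nat.even_iff] at hj
    rintro (h | h) <;> have := fin_val_of_eq_add_one h <;> omega

theorem isOrthogonalPartition_odd (j : ℕ) [NeZero j] (hj : Odd j) :
    IsOrthogonalPartition (cartan j) 3 (partsOdd j) := by
  refine ⟨?_, ?_, ?_⟩
  · intro a b hab
    rw [Finset.disjoint_left]
    intro k
    fin_cases a <;> fin_cases b <;>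
      simp [partsOdd, Nat.even_iff, Nat.odd_iff, -Fin.val_eq_zero_iff] at hab ⊢ <;> omega
  · intro k
    by_cases h0 : k.val = 0
    · exact ⟨2, by simpa [partsOdd, -Fin.val_eq_zero_iff] using h0⟩
    rcases Nat.even_or_odd k.val with h | h
    · exact ⟨0, by simpa [partsOdd, h] using h0⟩
    · exact ⟨1, by simp [partsOdd, h]⟩
  · intro a k hk l hl hkl
    rw [cartan_eq_zero_iff hkl]
    have hkl' : k.val ≠ l.val := fun h => hkl (Fin.ext h)
    rw [Nat.odd_iff] at hj
    have hk' := k.2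
    have hl' := l.2
    rintro (h | h) <;> have := fin_val_of_eq_add_one h <;>
      fin_cases a <;>
      simp only [partsOdd, Nat.even_iff, Nat.odd_iff, Finset.mem_filter, Finset.mem_univ, true_and,
        Matrix.cons_val_zero, Matrix.cons_val_one, Matrix.cons_val, Fin.zero_eta, Fin.mk_one,
        Fin.reduceFinMk] at hk hl <;> omega

theorem cartanGraph_adj (j : ℕ) [NeZero j] (k l : Fin j) :
    (cartanGraph (cartan j)).Adj k l ↔ k ≠ l ∧ (k = l + 1 ∨ l = k + 1) := by
  rw [cartanGraph, SimpleGraph.fromRel_adj]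
  refine and_congr_right fun h => ?_
  rw [Ne, Ne, cartan_eq_zero_iff h, cartan_eq_zero_iff h.symm, not_not, not_not,
    or_comm (a := l = _), or_self]

theorem cartanGraph_eq_cycleGraph (j : ℕ) [NeZero j] :
    cartanGraph (cartan j) = SimpleGraph.cycleGraph j := by
  obtain ⟨n, rfl⟩ : ∃ n, j = n + 1 := ⟨j - 1, by have := NeZero.ne j; omega⟩
  ext k l
  rw [cartanGraph_adj, SimpleGraph.cycleGraph_eq_circulantGraph, SimpleGraph.circulantGraph_adj]
  simp [sub_eq_iff_eq_add, add_comm]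

theorem le_of_isOrthogonalPartition (j : ℕ) [NeZero j] (hj : 2 ≤ j) {p : ℕ}
    {S : Fin p → Finset (Fin j)} (h : IsOrthogonalPartition (cartan j) p S) :
    (if Even j then 2 else 3) ≤ p := by
  choose c hc using h.2.1
  -- the index of the part containing a vertex is a colouring of the graph
  have hcol : (SimpleGraph.cycleGraph j).Colorable p := by
    refine ⟨SimpleGraph.Coloring.mk c fun {k l} hkl hcc => ?_⟩
    rw [← cartanGraph_eq_cycleGraph, cartanGraph_adj] at hkl
    exact (cartan_eq_zero_iff hkl.1).mp (h.2.2 (c k) k (hc k) l (hcc ▸ hc l) hkl.1) hkl.2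
  have hle := hcol.chromaticNumber_le
  split_ifs with he
  · rw [SimpleGraph.chromaticNumber_cycleGraph_of_even j hj he] at hle
    exact_mod_cast hle
  · rw [SimpleGraph.chromaticNumber_cycleGraph_of_odd j hj (Nat.not_even_iff_odd.mp he)] at hle
    exact_mod_cast hle

theorem mcKayMatrix_two (j : ℕ) [NeZero j] (hj : j = 2) (i k : Fin j) :
    mcKayMatrix j i k = if i = k then 1 else 2 := by
  rw [mcKayMatrix_apply]
  subst hj
  fin_cases i <;> fin_cases k <;> simp

theorem mcKayMatrix_of_three_le (j : ℕ) [NeZero j] (hj : 3 ≤ j) (i k : Fin j) :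
    mcKayMatrix j i k = if i = k ∨ i = k + 1 ∨ k = i + 1 then 1 else 0 := by
  rw [mcKayMatrix_apply]
  have h1 : i = k → ¬ i = k + 1 := by
    rintro rfl h
    have := fin_val_of_eq_add_one h
    omega
  have h2 : i = k → ¬ k = i + 1 := by
    rintro rfl h
    have := fin_val_of_eq_add_one h
    omega
  have h3 : i = k + 1 → ¬ k = i + 1 := by
    intro h h'
    have := fin_val_of_eq_add_one h
    have := fin_val_of_eq_add_one h'
    omega
  by_cases e1 : i = k
  · rw [if_neg (h1 e1), if_pos e1, if_neg (h2 e1), if_pos (Or.inl e1)]; rfl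
  by_cases e2 : i = k + 1
  · rw [if_pos e2, if_neg e1, if_neg (h3 e2), if_pos (Or.inr (Or.inl e2))]; rfl
  rw [if_neg e2, if_neg e1]
  simp only [e1, e2, false_or, zero_add]

open MvPolynomial

/-! ### Bihomogeneous polynomials -/

/-- The bidegree of the variables: `(1, 0)` for a vector, `(0, 1)` for a covector. -/
def bideg : Fin 3 ⊕ Fin 3 → (Fin 2 →₀ ℕ) :=
  Sum.elim (fun _ => Finsupp.single 0 1) (fun _ => Finsupp.single 1 1)

/-- The bidegree `(1, 1)`. -/
def oneOne : Fin 2 →₀ ℕ := Finsupp.single 0 1 + Finsupp.single 1 1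

/-- The bidegree `(m, n)`. -/
def bi (m n : ℕ) : Fin 2 →₀ ℕ := Finsupp.single 0 m + Finsupp.single 1 n

theorem bi_zero (m n : ℕ) : bi m n 0 = m := by simp [bi]

theorem bi_one (m n : ℕ) : bi m n 1 = n := by simp [bi]

theorem weight_bideg_zero (d : Fin 3 ⊕ Fin 3 →₀ ℕ) :
    Finsupp.weight bideg d 0 = d (.inl 0) + d (.inl 1) + d (.inl 2) := by
  rw [Finsupp.weight_eq_sum, Finsupp.finsetSum_apply]
  simp [Fintype.sum_sum_type, Fin.sum_univ_three, bideg]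

theorem weight_bideg_one (d : Fin 3 ⊕ Fin 3 →₀ ℕ) :
    Finsupp.weight bideg d 1 = d (.inr 0) + d (.inr 1) + d (.inr 2) := by
  rw [Finsupp.weight_eq_sum, Finsupp.finsetSum_apply]
  simp [Fintype.sum_sum_type, Fin.sum_univ_three, bideg]

/-- The exponents of bidegree `e`. -/
def bidegSet (e : Fin 2 →₀ ℕ) : Finset (Fin 3 ⊕ Fin 3 →₀ ℕ) :=
  (Finset.univ.finsuppAntidiag (e 0 + e 1)).filter fun d => Finsupp.weight bideg d = e

theorem mem_bidegSet {e : Fin 2 →₀ ℕ} {d : Fin 3 ⊕ Fin 3 →₀ ℕ} :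
    d ∈ bidegSet e ↔ Finsupp.weight bideg d = e := by
  rw [bidegSet, Finset.mem_filter, and_iff_right_iff_imp]
  rintro rfl
  rw [Finset.mem_finsuppAntidiag]
  refine ⟨?_, Finset.subset_univ _⟩
  rw [weight_bideg_zero, weight_bideg_one, Fintype.sum_sum_type, Fin.sum_univ_three,
    Fin.sum_univ_three]

/-- `Sym^m E ⊗ Sym^n E*`, for `e = (m, n)`. -/
abbrev biPoly (e : Fin 2 →₀ ℕ) : Submodule ℂ SymPoly := weightedHomogeneousSubmodule ℂ bideg e

theorem support_subset_of_mem_biPoly {e : Fin 2 →₀ ℕ} {F : SymPoly} (hF : F ∈ biPoly e) :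
    F.support ⊆ bidegSet e := fun _ hd => mem_bidegSet.mpr (hF (MvPolynomial.mem_support_iff.mp hd))

theorem biPoly_eq_restrictSupport (e : Fin 2 →₀ ℕ) :
    biPoly e = restrictSupport ℂ (bidegSet e : Set (Fin 3 ⊕ Fin 3 →₀ ℕ)) := by
  ext F
  rw [mem_restrictSupport_iff]
  refine ⟨fun h => Finset.coe_subset.mpr (support_subset_of_mem_biPoly h), fun h d hd => ?_⟩
  exact mem_bidegSet.mp (h (MvPolynomial.mem_support_iff.mpr hd))

theorem finite_restrictSupport {s : Set (Fin 3 ⊕ Fin 3 →₀ ℕ)} (hs : s.Finite) :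
    Module.Finite ℂ (restrictSupport ℂ s) :=
  have := hs.to_subtype
  Module.Finite.of_basis (basisRestrictSupport ℂ s)

instance (e : Fin 2 →₀ ℕ) : FiniteDimensional ℂ (biPoly e) := by
  rw [biPoly_eq_restrictSupport]
  exact finite_restrictSupport (Finset.finite_toSet _)

/-- A substitution rescaling each variable acts diagonally on monomials. -/
theorem coeff_aeval_C_mul_X (c : Fin 3 ⊕ Fin 3 → ℂ) (F : SymPoly) (d : Fin 3 ⊕ Fin 3 →₀ ℕ) :
    coeff d (aeval (fun i => C (c i) * X i : Fin 3 ⊕ Fin 3 → SymPoly) F) =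
      (∏ i, c i ^ d i) * coeff d F := by
  induction F using MvPolynomial.induction_on' with
  | monomial u a =>
    have : aeval (fun i => C (c i) * X i : Fin 3 ⊕ Fin 3 → SymPoly) (monomial u a) =
        monomial u (a * ∏ i, c i ^ u i) := by
      rw [aeval_monomial, Finsupp.prod_fintype _ _ (fun _ => pow_zero _)]
      simp only [mul_pow, Finset.prod_mul_distrib, ← C_pow, ← map_prod]
      rw [← mul_assoc, MvPolynomial.algebraMap_eq, ← C_mul, MvPolynomial.monomial_eq,
        Finsupp.prod_fintype _ _ (fun _ => pow_zero _)]
    rw [this, coeff_monomial, coeff_monomial]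
    split_ifs with h
    · rw [h, mul_comm]
    · simp
  | add p q hp hq => rw [map_add, coeff_add, coeff_add, hp, hq, mul_add]

/-- The characters of the diagonal torus: the scalars by which `diag t` acts on the variables. -/
def torusWeight (t : Fin 3 → ℂ) : Fin 3 ⊕ Fin 3 → ℂ := Sum.elim t fun k => (t k)⁻¹

theorem coeff_symAct_diagonal {g : SL3} {t : Fin 3 → ℂ} (hg : g.1 = Matrix.diagonal t)
    (F : SymPoly) (d : Fin 3 ⊕ Fin 3 →₀ ℕ) :
    coeff d (symAct g F) = (∏ i, torusWeight t i ^ d i) * coeff d F := by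
  have ht : ∀ k, t k ≠ 0 := by
    have h := g.2
    rw [hg, Matrix.det_diagonal] at h
    intro k hk
    rw [Finset.prod_eq_zero (Finset.mem_univ k) hk] at h
    exact zero_ne_one h
  have hinv : (g⁻¹).1 = Matrix.diagonal fun k => (t k)⁻¹ := by
    have h1 : g.1 * (g⁻¹).1 = 1 := by
      rw [← Matrix.SpecialLinearGroup.coe_mul, mul_inv_cancel, Matrix.SpecialLinearGroup.coe_one]
    have h2 : Matrix.diagonal (fun k => (t k)⁻¹) * g.1 = 1 := by
      rw [hg, Matrix.diagonal_mul_diagonal]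
      simp [ht]
    exact (left_inv_eq_right_inv h2 h1).symm
  rw [← coeff_aeval_C_mul_X]
  congr 1
  refine DFunLike.congr_fun (MvPolynomial.algHom_ext ?_ : symAct g = _) F
  rintro (k | k)
  · rw [symAct_inl, hg, aeval_X, Finset.sum_eq_single k]
    · simp [torusWeight]
    · intro i _ hi
      simp [hi]
    · simp
  · rw [symAct_inr, hinv, aeval_X, Finset.sum_eq_single k]
    · simp [torusWeight]
    · intro i _ hi
      simp [hi.symm]
    · simp

/-! ### The incidence quadric -/

/-- The invariant form `∑ e k ⊗ e* k`: the equation of the pairs (vector, covector) with the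
vector in the kernel of the covector. -/
def incidence : SymPoly := ∑ k : Fin 3, X (Sum.inl k) * X (Sum.inr k)

theorem incidence_prime : Prime incidence := by
  have h := MvPolynomial.irreducible_sumSMulXSMulY (R := ℂ)
    (Finsupp.equivFunOnFinite.symm fun _ : Fin 3 => (1 : ℂ))
    ⟨0, by simp, 1, by simp, by decide⟩ (fun r hr => isUnit_of_dvd_one (hr 0))
  have e : MvPolynomial.sumSMulXSMulY (Finsupp.equivFunOnFinite.symm fun _ : Fin 3 => (1 : ℂ)) =
      incidence := by
    rw [MvPolynomial.sumSMulXSMulY, Finsupp.linearCombination_apply,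
      Finsupp.sum_fintype _ _ (by simp)]
    simp [incidence]
  rw [e] at h
  exact h.prime

theorem incidence_mem_biPoly : incidence ∈ biPoly oneOne :=
  Submodule.sum_mem _ fun k _ =>
    (isWeightedHomogeneous_X ℂ bideg (Sum.inl k)).mul (isWeightedHomogeneous_X ℂ bideg (Sum.inr k))

theorem eval_incidence (p : Fin 3 ⊕ Fin 3 → ℂ) :
    eval p incidence = ∑ k, p (Sum.inl k) * p (Sum.inr k) := by simp [incidence]

/-- Cofactors of an incidence-divisible bihomogeneous polynomial are bihomogeneous. -/
theorem weight_of_incidence_mul_mem {e : Fin 2 →₀ ℕ} {h : SymPoly}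
    (hh : incidence * h ∈ biPoly e) {d : Fin 3 ⊕ Fin 3 →₀ ℕ} (hd : coeff d h ≠ 0) :
    oneOne + Finsupp.weight bideg d = e := by
  classical
  let := weightedGradedAlgebra ℂ bideg
  let : AddLeftCancelMonoid (Fin 2 →₀ ℕ) :=
    { (inferInstance : AddMonoid (Fin 2 →₀ ℕ)) with
      add_left_cancel := fun _ _ _ h => add_left_cancel h }
  by_contra hne
  have h1 := DirectSum.coe_decompose_mul_add_of_left_mem (weightedHomogeneousSubmodule ℂ bideg)
    (i := oneOne) (j := Finsupp.weight bideg d) (b := h) incidence_mem_biPoly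
  have h2 : ((DirectSum.decompose (weightedHomogeneousSubmodule ℂ bideg) (incidence * h)
      (oneOne + Finsupp.weight bideg d)) : SymPoly) = 0 :=
    DirectSum.decompose_of_mem_ne (weightedHomogeneousSubmodule ℂ bideg) hh (Ne.symm hne)
  have h3 := (mul_eq_zero.mp (h1.symm.trans h2)).resolve_left incidence_prime.ne_zero
  have h4 := congrArg (coeff d)
    ((weightedDecomposition.decompose'_apply ℂ bideg h (Finsupp.weight bideg d)).symm.trans h3)
  rw [coeff_weightedHomogeneousComponent, if_pos rfl] at h4
  exact hd h4

/-- The pair (first column of `g`, third row of `g⁻¹`): an incident vector and covector. -/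
def flagPoint (g : SL3) : Fin 3 ⊕ Fin 3 → ℂ :=
  Sum.elim (fun i => g.1 i 0) (fun i => (g⁻¹).1 2 i)

theorem eval_flagPoint_incidence (g : SL3) : eval (flagPoint g) incidence = 0 := by
  have h1 : (g⁻¹).1 * g.1 = 1 := by
    rw [← Matrix.SpecialLinearGroup.coe_mul, inv_mul_cancel, Matrix.SpecialLinearGroup.coe_one]
  have h2 := congrFun (congrFun h1 2) 0
  rw [Matrix.mul_apply] at h2
  rw [eval_incidence]
  simpa [flagPoint, mul_comm] using h2

theorem exists_flagPoint_eq (p : Fin 3 ⊕ Fin 3 → ℂ) (hp : eval p incidence = 0)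
    (hx : p (.inl 0) ≠ 0) (hy : p (.inr 0) ≠ 0) : ∃ g : SL3, flagPoint g = p := by
  rw [eval_incidence, Fin.sum_univ_three] at hp
  set x0 := p (.inl 0) with hx0
  set x1 := p (.inl 1) with hx1
  set x2 := p (.inl 2) with hx2
  set y0 := p (.inr 0) with hy0
  set y1 := p (.inr 1) with hy1
  set y2 := p (.inr 2) with hy2
  -- the cross product of the first two columns is the given covector
  have hdet : (!![x0, 0, y0⁻¹; x1, y2 / x0, 0; x2, -y1 / x0, 0]).det = 1 := by
    rw [Matrix.det_fin_three]
    simp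
    field_simp
    linear_combination -hp
  let g : SL3 := ⟨_, hdet⟩
  have hinv : (g⁻¹).1 =
      (!![x0, 0, y0⁻¹; x1, y2 / x0, 0; x2, -y1 / x0, 0]).adjugate := rfl
  refine ⟨g, ?_⟩
  · funext k
    rcases k with k | k
    · fin_cases k <;> rfl
    · rw [flagPoint, Sum.elim_inr, hinv, Matrix.adjugate_fin_three]
      fin_cases k
      · simp
        field_simp
        linear_combination -hp
      · simp
        field_simp
        simp [hy1]
      · simp
        field_simp
        simp [hy2]

/-- The Nullstellensatz for the incidence quadric; the flags with nonvanishing first coordinates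
are enough because `incidence` is prime and divides neither of these coordinates. -/
theorem incidence_dvd_of_eval_flagPoint {F : SymPoly} (hF : ∀ g : SL3, eval (flagPoint g) F = 0) :
    incidence ∣ F := by
  have hprime : (Ideal.span {incidence}).IsPrime :=
    (Ideal.span_singleton_prime incidence_prime.ne_zero).mpr incidence_prime
  have hmem : F * (X (Sum.inl 0) * X (Sum.inr 0)) ∈ Ideal.span {incidence} := by
    rw [← hprime.radical, ← vanishingIdeal_zeroLocus_eq_radical (K := ℂ), mem_vanishingIdeal_iff]
    intro p hp
    have hp' : eval p incidence = 0 := by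
      simpa using mem_zeroLocus_iff.mp hp incidence (Ideal.mem_span_singleton_self _)
    change (RingHomClass.toRingHom (aeval p : SymPoly →ₐ[ℂ] ℂ)) _ = 0
    rw [MvPolynomial.coe_aeval_eq_eval]
    by_cases hx : p (.inl 0) = 0
    · simp [hx]
    by_cases hy : p (.inr 0) = 0
    · simp [hy]
    obtain ⟨g, rfl⟩ := exists_flagPoint_eq p hp' hx hy
    simp [hF]
  rw [Ideal.mem_span_singleton] at hmem
  have hno : ∀ (i : Fin 3 ⊕ Fin 3), ¬ incidence ∣ X i := by
    rintro i ⟨h, hh⟩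
    -- the `i`-th basis vector, paired with the zero covector (or vector), is on the quadric
    have key : ∀ p : Fin 3 ⊕ Fin 3 → ℂ, eval p incidence = 0 → p i = 0 := by
      intro p hp
      have := congrArg (eval p) hh
      rwa [map_mul, hp, zero_mul, eval_X] at this
    have := key (Pi.single i 1) (by
      rw [eval_incidence]
      refine Finset.sum_eq_zero fun k _ => ?_
      rcases i with i | i <;> simp [Pi.single_apply])
    simp at this
  rcases incidence_prime.dvd_or_dvd hmem with h | h
  · exact h
  · rcases incidence_prime.dvd_or_dvd h with h | h
    · exact absurd h (hno _)
    · exact absurd h (hno _)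

/-! ### The Fischer inner product -/

/-- The product of powers `ℓ^m f^n` of the linear forms with coefficient vector `p`. -/
def linPow (p : Fin 3 ⊕ Fin 3 → ℂ) (m n : ℕ) : SymPoly :=
  (∑ i, C (p (.inl i)) * X (.inl i)) ^ m * (∑ i, C (p (.inr i)) * X (.inr i)) ^ n

theorem symRep_hwVector (g : SL3) (m n : ℕ) :
    symRep g (hwVector m n) = linPow (flagPoint g) m n := by
  change symAct g _ = _
  rw [hwVector, map_mul, map_pow, map_pow, symAct_inl, symAct_inr]
  rfl

theorem linPow_mem_biPoly (p : Fin 3 ⊕ Fin 3 → ℂ) (m n : ℕ) : linPow p m n ∈ biPoly (bi m n) := by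
  have h0 : (∑ i, C (p (.inl i)) * X (.inl i) : SymPoly) ∈ biPoly (Finsupp.single 0 1) :=
    Submodule.sum_mem _ fun k _ => (isWeightedHomogeneous_X ℂ bideg (Sum.inl k)).C_mul _
  have h1 : (∑ i, C (p (.inr i)) * X (.inr i) : SymPoly) ∈ biPoly (Finsupp.single 1 1) :=
    Submodule.sum_mem _ fun k _ => (isWeightedHomogeneous_X ℂ bideg (Sum.inr k)).C_mul _
  have h := (IsWeightedHomogeneous.pow h0 m).mul (IsWeightedHomogeneous.pow h1 n)
  have e : m • Finsupp.single (0 : Fin 2) 1 + n • Finsupp.single (1 : Fin 2) 1 = bi m n := by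
    simp [bi]
  rw [e] at h
  exact h

/-- The coefficients of `ℓ^m f^n`, read off from the multinomial expansion of `(ℓ + f)^(m + n)`,
of which `choose (m + n) m • ℓ^m f^n` is the component of bidegree `(m, n)`. -/
theorem choose_mul_coeff_linPow (p : Fin 3 ⊕ Fin 3 → ℂ) (m n : ℕ) {d : Fin 3 ⊕ Fin 3 →₀ ℕ}
    (hd : d ∈ bidegSet (bi m n)) :
    ((m + n).choose m : ℂ) * coeff d (linPow p m n) =
      (d.multinomial : ℂ) * ∏ i, p i ^ d i := by
  rw [mem_bidegSet] at hd
  have h := coeff_linearCombination_X_pow_of_fintype p d (m + n)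
  have hdeg : d.sum (fun _ k => k) = m + n := by
    rw [Finsupp.sum_fintype _ _ (fun _ => rfl), Fintype.sum_sum_type, Fin.sum_univ_three,
      Fin.sum_univ_three, ← weight_bideg_zero, ← weight_bideg_one, hd, bi_zero, bi_one]
  rw [if_pos hdeg, Finsupp.prod_fintype _ _ (fun _ => pow_zero _)] at h
  rw [← h, Fintype.sum_sum_type]
  simp only [smul_eq_C_mul]
  rw [add_pow, coeff_sum, Finset.sum_eq_single m]
  · rw [Nat.add_sub_cancel_left, ← C_eq_coe_nat, mul_comm _ (C _), coeff_C_mul]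
    rfl
  · intro k hk hkm
    rw [← C_eq_coe_nat, mul_comm _ (C _), coeff_C_mul]
    have hz : coeff d (linPow p k (m + n - k)) = 0 := by
      refine IsWeightedHomogeneous.coeff_eq_zero (linPow_mem_biPoly p k (m + n - k)) d ?_
      rw [hd]
      intro he
      have := DFunLike.congr_fun he 0
      rw [bi_zero, bi_zero] at this
      exact hkm this.symm
    rw [linPow] at hz
    rw [hz, mul_zero]
  · intro hm
    exact absurd (Finset.mem_range.mpr (by omega)) hm

/-- The Fischer inner product in bidegree `e`, for which monomials are orthogonal; it is
antilinear in the first variable. -/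
def fischer (e : Fin 2 →₀ ℕ) (F G : SymPoly) : ℂ :=
  ∑ d ∈ bidegSet e, (d.multinomial : ℂ)⁻¹ * (star (coeff d F) * coeff d G)

theorem multinomial_ne_zero (d : Fin 3 ⊕ Fin 3 →₀ ℕ) : (d.multinomial : ℂ) ≠ 0 := by
  rw [Finsupp.multinomial_eq]
  exact_mod_cast (Nat.multinomial_pos _ _).ne'

theorem fischer_self (e : Fin 2 →₀ ℕ) (F : SymPoly) :
    fischer e F F = ((∑ d ∈ bidegSet e, (d.multinomial : ℝ)⁻¹ * ‖coeff d F‖ ^ 2 : ℝ) : ℂ) := by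
  rw [fischer, Complex.ofReal_sum]
  refine Finset.sum_congr rfl fun d _ => ?_
  have h : star (coeff d F) * coeff d F = (‖coeff d F‖ : ℂ) ^ 2 := Complex.conj_mul' _
  rw [h]
  push_cast
  rfl

theorem eq_zero_of_fischer_self {e : Fin 2 →₀ ℕ} {F : SymPoly} (hF : F ∈ biPoly e)
    (h : fischer e F F = 0) : F = 0 := by
  rw [fischer_self, Complex.ofReal_eq_zero, Finset.sum_eq_zero_iff_of_nonneg
    (fun d _ => by positivity)] at h
  ext d
  rw [coeff_zero]
  by_contra hd
  have h1 := h d (mem_bidegSet.mpr (hF hd))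
  have h2 : (d.multinomial : ℝ)⁻¹ ≠ 0 :=
    inv_ne_zero (by exact_mod_cast multinomial_ne_zero d)
  have h3 := (mul_eq_zero.mp h1).resolve_left h2
  exact hd (norm_eq_zero.mp (pow_eq_zero_iff two_ne_zero |>.mp h3))

/-- The reproducing property: pairing with `ℓ^m f^n` is evaluation at the conjugate point. -/
theorem fischer_linPow (p : Fin 3 ⊕ Fin 3 → ℂ) (m n : ℕ) {F : SymPoly} (hF : F ∈ biPoly (bi m n)) :
    ((m + n).choose m : ℂ) * fischer (bi m n) (linPow p m n) F =
      eval (fun i => star (p i)) F := by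
  rw [fischer, Finset.mul_sum, MvPolynomial.eval_eq', Finset.sum_subset
    (support_subset_of_mem_biPoly hF) (fun d _ hd => by
      rw [MvPolynomial.notMem_support_iff.mp hd, zero_mul])]
  refine Finset.sum_congr rfl fun d hd => ?_
  have h := congrArg star (choose_mul_coeff_linPow p m n hd)
  simp only [star_mul', star_prod, star_pow, star_natCast] at h
  have hm := multinomial_ne_zero d
  calc _ = (d.multinomial : ℂ)⁻¹ * ((((m + n).choose m : ℂ) * star (coeff d (linPow p m n)))
      * coeff d F) := by ring
    _ = _ := by rw [h]; field_simp

/-- Orthogonal projection for the Fischer inner product. -/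
theorem exists_fischer_projection (e : Fin 2 →₀ ℕ) (V : Submodule ℂ SymPoly) (hV : V ≤ biPoly e)
    {F : SymPoly} (hF : F ∈ biPoly e) :
    ∃ v ∈ V, ∀ u ∈ V, fischer e u (F - v) = 0 := by
  let core : InnerProductSpace.Core ℂ (biPoly e) :=
    { inner := fun F G => fischer e F.1 G.1
      conj_inner_symm := fun F G => by
        simp only [fischer, map_sum, map_mul, map_inv₀, map_natCast]
        refine Finset.sum_congr rfl fun d _ => ?_
        simp [mul_comm]
      re_inner_nonneg := fun F => by
        rw [fischer_self]
        exact_mod_cast Finset.sum_nonneg fun d _ => by positivity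
      add_left := fun F G H => by
        simp [fischer, add_mul, mul_add, Finset.sum_add_distrib]
      smul_left := fun F G a => by
        simp only [fischer, Finset.mul_sum]
        refine Finset.sum_congr rfl fun d _ => ?_
        simp
        ring
      definite := fun F h => Subtype.ext (eq_zero_of_fischer_self F.2 h) }
  let : NormedAddCommGroup (biPoly e) := core.toNormedAddCommGroup
  let : InnerProductSpace ℂ (biPoly e) := InnerProductSpace.ofCore core.toCore
  obtain ⟨v, hv, h⟩ := Submodule.HasOrthogonalProjection.exists_orthogonal
    (K := V.comap (biPoly e).subtype) ⟨F, hF⟩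
  exact ⟨v.1, hv, fun u hu => h ⟨u, hV hu⟩ hu⟩

/-! ### Irreducibility of the modules `V(m, n)` -/

theorem simpleSub_le_iff {m n : ℕ} {W : Submodule ℂ SymPoly} :
    (simpleSub m n).toSubmodule ≤ W ↔ ∀ g : SL3, linPow (flagPoint g) m n ∈ W := by
  change Submodule.span ℂ _ ≤ W ↔ _
  rw [Submodule.span_le, Set.range_subset_iff]
  exact forall_congr' fun g => by rw [symRep_hwVector]; rfl

theorem linPow_mem_simpleSub (g : SL3) (m n : ℕ) :
    linPow (flagPoint g) m n ∈ (simpleSub m n).toSubmodule :=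
  simpleSub_le_iff.mp le_rfl g

theorem simpleSub_le_biPoly (m n : ℕ) : (simpleSub m n).toSubmodule ≤ biPoly (bi m n) :=
  simpleSub_le_iff.mpr fun _ => linPow_mem_biPoly _ m n

instance (m n : ℕ) : FiniteDimensional ℂ (simpleSub m n).toSubmodule :=
  Submodule.finiteDimensional_of_le (simpleSub_le_biPoly m n)

theorem flagPoint_star (g : SL3) : ∃ h : SL3, flagPoint h = fun i => star (flagPoint g i) := by
  refine ⟨g.map (starRingEnd ℂ), funext fun i => ?_⟩
  rcases i with i | i
  · rfl
  · change ((g.map (starRingEnd ℂ))⁻¹).1 2 i = star ((g⁻¹).1 2 i)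
    rw [← map_inv]
    rfl

/-- Within its bidegree, the orthogonal complement of `V(m, n)` consists of the multiples of the
incidence form. -/
theorem forall_fischer_eq_zero_iff {m n : ℕ} {F : SymPoly} (hF : F ∈ biPoly (bi m n)) :
    (∀ v ∈ (simpleSub m n).toSubmodule, fischer (bi m n) v F = 0) ↔ incidence ∣ F := by
  have hch : ((m + n).choose m : ℂ) ≠ 0 := by
    exact_mod_cast (Nat.choose_pos (Nat.le_add_right m n)).ne'
  constructor
  · intro h
    refine incidence_dvd_of_eval_flagPoint fun g => ?_
    obtain ⟨k, hk⟩ := flagPoint_star g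
    have h1 := fischer_linPow (flagPoint k) m n hF
    rw [h _ (linPow_mem_simpleSub k m n), mul_zero, hk] at h1
    simpa using h1.symm
  · rintro ⟨G, rfl⟩ v hv
    let W : Submodule ℂ SymPoly :=
      { carrier := {v | fischer (bi m n) v (incidence * G) = 0}
        zero_mem' := by simp [fischer]
        add_mem' := fun {a b} ha hb => by
          simp only [Set.mem_ofPred_eq, fischer] at *
          simp only [coeff_add, star_add, add_mul, mul_add, Finset.sum_add_distrib, ha, hb, add_zero]
        smul_mem' := fun c a ha => by
          simp only [Set.mem_ofPred_eq, fischer] at *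
          simp only [coeff_smul, smul_eq_mul, star_mul', mul_assoc, mul_left_comm _ (star c),
            ← Finset.mul_sum, ha, mul_zero] }
    refine (simpleSub_le_iff (W := W)).mpr (fun g => ?_) hv
    obtain ⟨k, hk⟩ := flagPoint_star g
    have h1 := fischer_linPow (flagPoint g) m n hF
    rw [← hk, map_mul, eval_flagPoint_incidence, zero_mul] at h1
    exact (mul_eq_zero.mp h1).resolve_left hch

/-- `V(m, n)` meets the ideal of the incidence form trivially. -/
theorem eq_zero_of_incidence_dvd {m n : ℕ} {v : SymPoly} (hv : v ∈ (simpleSub m n).toSubmodule)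
    (h : incidence ∣ v) : v = 0 :=
  eq_zero_of_fischer_self (simpleSub_le_biPoly m n hv)
    ((forall_fischer_eq_zero_iff (simpleSub_le_biPoly m n hv)).mpr h v hv)

/-- `Sym^m E ⊗ Sym^n E*` is the sum of `V(m, n)` and the multiples of the incidence form. -/
theorem exists_incidence_dvd_sub {m n : ℕ} {F : SymPoly} (hF : F ∈ biPoly (bi m n)) :
    ∃ v ∈ (simpleSub m n).toSubmodule, incidence ∣ F - v := by
  obtain ⟨v, hv, h⟩ := exists_fischer_projection _ _ (simpleSub_le_biPoly m n) hF
  exact ⟨v, hv, (forall_fischer_eq_zero_iff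
    (Submodule.sub_mem _ hF (simpleSub_le_biPoly m n hv))).mp h⟩

/-- The exponent of the highest weight vector. -/
def hwExp (m n : ℕ) : Fin 3 ⊕ Fin 3 →₀ ℕ :=
  Finsupp.single (.inl 0) m + Finsupp.single (.inr 2) n

theorem hwVector_eq_monomial (m n : ℕ) : hwVector m n = monomial (hwExp m n) 1 := by
  rw [hwVector, hwExp, X_pow_eq_monomial, X_pow_eq_monomial, monomial_mul, one_mul]

theorem hwVector_mem (m n : ℕ) : hwVector m n ∈ (simpleSub m n).toSubmodule :=
  Submodule.subset_span ⟨1, by simp⟩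

theorem hwVector_ne_zero (m n : ℕ) : hwVector m n ≠ 0 := by
  rw [hwVector_eq_monomial, Ne, monomial_eq_zero]
  exact one_ne_zero

theorem eq_hwExp_of_le {m n : ℕ} {d : Fin 3 ⊕ Fin 3 →₀ ℕ} (hd : d ∈ bidegSet (bi m n))
    (h0 : m + n + (d (.inl 2) + d (.inr 0)) ≤ d (.inl 0) + d (.inr 2)) : d = hwExp m n := by
  rw [mem_bidegSet] at hd
  have h1 := weight_bideg_zero d
  have h2 := weight_bideg_one d
  rw [hd, bi_zero] at h1
  rw [hd, bi_one] at h2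
  ext i
  rcases i with i | i <;> fin_cases i <;> simp [hwExp] <;> omega

/-- The element `diag(2, 1, 1/2)`; the eigenvalue of the highest weight vector is larger than the
eigenvalues of all the other monomials of the same bidegree. -/
def torusElt : SL3 := ⟨Matrix.diagonal ![2, 1, 2⁻¹], by
  rw [Matrix.det_diagonal, Fin.prod_univ_three]; simp⟩

theorem torusElt_weight (d : Fin 3 ⊕ Fin 3 →₀ ℕ) :
    ∏ i, torusWeight ![2, 1, 2⁻¹] i ^ d i =
      2 ^ (d (.inl 0) + d (.inr 2)) / 2 ^ (d (.inl 2) + d (.inr 0)) := by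
  rw [Fintype.prod_sum_type, Fin.prod_univ_three, Fin.prod_univ_three]
  simp [torusWeight]
  field_simp
  ring

theorem eq_hwExp_of_weight_eq {m n : ℕ} {d : Fin 3 ⊕ Fin 3 →₀ ℕ} (hd : d ∈ bidegSet (bi m n))
    (h : ∏ i, torusWeight ![2, 1, 2⁻¹] i ^ d i = ∏ i, torusWeight ![2, 1, 2⁻¹] i ^ hwExp m n i) :
    d = hwExp m n := by
  rw [torusElt_weight, torusElt_weight, div_eq_iff (pow_ne_zero _ two_ne_zero)] at h
  have h1 : ((2 ^ (d (.inl 0) + d (.inr 2)) : ℕ) : ℂ) =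
      ((2 ^ (m + n + (d (.inl 2) + d (.inr 0))) : ℕ) : ℂ) := by
    push_cast
    rw [h, pow_add 2 (m + n)]
    simp [hwExp]
  exact eq_hwExp_of_le hd (Nat.pow_right_injective le_rfl (Nat.cast_injective h1)).ge

/-- A subspace stable under an operator that is diagonal on monomials contains the monomials whose
eigenvalue is simple among those occurring in one of its elements. -/
theorem monomial_mem_of_stable {W : Submodule ℂ SymPoly} {T : SymPoly →ₗ[ℂ] SymPoly}
    {χ : (Fin 3 ⊕ Fin 3 →₀ ℕ) → ℂ} (hT : ∀ F d, coeff d (T F) = χ d * coeff d F)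
    (hW : ∀ F ∈ W, T F ∈ W) {F : SymPoly} (hF : F ∈ W) {d₀ : Fin 3 ⊕ Fin 3 →₀ ℕ}
    (h0 : coeff d₀ F ≠ 0) (hχ : ∀ d ∈ F.support, χ d = χ d₀ → d = d₀) :
    monomial d₀ 1 ∈ W := by
  classical
  have key : ∀ R : Finset (Fin 3 ⊕ Fin 3 →₀ ℕ), ∃ G ∈ W, ∀ d,
      coeff d G = (∏ r ∈ R, (χ d - χ r)) * coeff d F := by
    intro R
    induction R using Finset.induction_on with
    | empty => exact ⟨F, hF, by simp⟩
    | insert r R hr ih =>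
      obtain ⟨G, hG, h⟩ := ih
      refine ⟨T G - χ r • G, W.sub_mem (hW G hG) (W.smul_mem _ hG), fun d => ?_⟩
      rw [coeff_sub, hT, coeff_smul, h, Finset.prod_insert hr, smul_eq_mul]
      ring
  obtain ⟨G, hG, h⟩ := key (F.support.erase d₀)
  have hc : (∏ r ∈ F.support.erase d₀, (χ d₀ - χ r)) * coeff d₀ F ≠ 0 := by
    refine mul_ne_zero (Finset.prod_ne_zero_iff.mpr fun r hr => ?_) h0
    rw [Finset.mem_erase] at hr
    exact sub_ne_zero.mpr fun he => hr.1 (hχ r hr.2 he.symm)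
  have hGe : G = ((∏ r ∈ F.support.erase d₀, (χ d₀ - χ r)) * coeff d₀ F) • monomial d₀ 1 := by
    ext d
    rw [h, coeff_smul, coeff_monomial]
    split_ifs with hd
    · rw [← hd, smul_eq_mul, mul_one]
    · rw [smul_zero]
      by_cases hs : coeff d F = 0
      · rw [hs, mul_zero]
      · rw [Finset.prod_eq_zero (i := d)
          (Finset.mem_erase.mpr ⟨Ne.symm hd, MvPolynomial.mem_support_iff.mpr hs⟩) (sub_self _),
          zero_mul]
  rw [hGe] at hG
  exact (W.smul_mem_iff hc).mp hG

/-- The coefficient of the highest weight vector in a translate of `F` is the value of `F` at a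
flag, and every flag arises in this way. -/
theorem exists_coeff_hwExp_symAct (g : SL3) : ∃ k : SL3, ∀ {m n : ℕ} {F : SymPoly},
    symAct k F ∈ biPoly (bi m n) → coeff (hwExp m n) (symAct k F) = eval (flagPoint g) F := by
  refine ⟨g.transpose, fun {m n F} hF => ?_⟩
  let p₀ : Fin 3 ⊕ Fin 3 → ℂ := Sum.elim (Pi.single 0 1) (Pi.single 2 1)
  have h1 : ∀ G ∈ biPoly (bi m n), eval p₀ G = coeff (hwExp m n) G := by
    intro G hG
    rw [MvPolynomial.eval_eq', Finset.sum_eq_single (hwExp m n)]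
    · rw [Fintype.prod_sum_type, Fin.prod_univ_three, Fin.prod_univ_three]
      simp [p₀, hwExp]
    · intro d hd hne
      have hd' := support_subset_of_mem_biPoly hG hd
      have hex : ∃ i, p₀ i ^ d i = 0 := by
        by_contra hcon
        push Not at hcon
        have hz : ∀ i, p₀ i = 0 → d i = 0 := fun i hi => by
          by_contra hdi
          exact hcon i (by rw [hi, zero_pow hdi])
        refine hne (eq_hwExp_of_le hd' ?_)
        have e1 := hz (.inl 1) (by simp [p₀])
        have e2 := hz (.inl 2) (by simp [p₀])
        have e3 := hz (.inr 0) (by simp [p₀])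
        have e4 := hz (.inr 1) (by simp [p₀])
        rw [mem_bidegSet] at hd'
        have w0 := weight_bideg_zero d
        have w1 := weight_bideg_one d
        rw [hd', bi_zero] at w0
        rw [hd', bi_one] at w1
        omega
      obtain ⟨i, hi⟩ := hex
      rw [Finset.prod_eq_zero (Finset.mem_univ i) hi, mul_zero]
    · intro hd
      rw [MvPolynomial.notMem_support_iff.mp hd, zero_mul]
  rw [← h1 _ hF]
  have h2 : (eval p₀).comp (symAct g.transpose : SymPoly →+* SymPoly) = eval (flagPoint g) := by
    apply MvPolynomial.ringHom_ext
    · intro a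
      simp
    · rintro (i | i)
      · simp [symAct_inl, p₀, flagPoint, Pi.single_apply]
      · have e : (g.transpose⁻¹).1 = (g⁻¹).1.transpose := by
          change (g.1.transpose).adjugate = (g.1.adjugate).transpose
          rw [Matrix.adjugate_transpose]
        simp only [RingHom.comp_apply, RingHom.coe_coe, symAct_inr, e, eval_X]
        simp [p₀, flagPoint, Pi.single_apply]
  exact RingHom.congr_fun h2 F

/-- Every nonzero invariant subspace of `V(m, n)` contains the highest weight vector: some
element of it does not vanish at some flag, so that some translate involves the highest weight
vector, which the torus isolates. -/
theorem simpleSub_le_of_invariant {m n : ℕ} {W : Submodule ℂ SymPoly}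
    (hW : W ≤ (simpleSub m n).toSubmodule) (hinv : ∀ g : SL3, ∀ F ∈ W, symAct g F ∈ W)
    {w : SymPoly} (hw : w ∈ W) (hw0 : w ≠ 0) : (simpleSub m n).toSubmodule ≤ W := by
  have hex : ∃ g : SL3, eval (flagPoint g) w ≠ 0 := by
    by_contra hcon
    push Not at hcon
    exact hw0 (eq_zero_of_incidence_dvd (hW hw) (incidence_dvd_of_eval_flagPoint hcon))
  obtain ⟨g, hg⟩ := hex
  obtain ⟨k, hk⟩ := exists_coeff_hwExp_symAct g
  have hkW := hinv k w hw
  have hkP := simpleSub_le_biPoly m n (hW hkW)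
  have hmem : hwVector m n ∈ W := by
    rw [hwVector_eq_monomial]
    refine monomial_mem_of_stable (T := (symAct torusElt).toLinearMap)
      (χ := fun d => ∏ i, torusWeight ![2, 1, 2⁻¹] i ^ d i)
      (fun F d => coeff_symAct_diagonal rfl F d) (hinv torusElt) hkW ?_ ?_
    · rw [hk hkP]
      exact hg
    · intro d hd h
      exact eq_hwExp_of_weight_eq (support_subset_of_mem_biPoly hkP hd) h
  exact simpleSub_le_iff.mpr fun g => symRep_hwVector g m n ▸ hinv g _ hmem

theorem simpleRep_isIrreducible (m n : ℕ) : (simpleRep m n).IsIrreducible := by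
  have hne : (⟨hwVector m n, hwVector_mem m n⟩ : (simpleSub m n).toSubmodule) ≠ 0 :=
    fun h => hwVector_ne_zero m n (congrArg Subtype.val h)
  refine { exists_pair_ne := ⟨⊥, ⊤, fun h => hne ?_⟩, eq_bot_or_eq_top := fun W => ?_ }
  · have h1 : (⊥ : Submodule ℂ (simpleSub m n).toSubmodule) = ⊤ :=
      congrArg Subrepresentation.toSubmodule h
    exact (Submodule.mem_bot ℂ).mp (h1 ▸ Submodule.mem_top)
  · by_cases hW : W.toSubmodule = ⊥
    · exact Or.inl (Subrepresentation.toSubmodule_injective hW)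
    · right
      obtain ⟨w, hw, hw0⟩ := Submodule.exists_mem_ne_zero_of_ne_bot hW
      have hle := simpleSub_le_of_invariant
        (W := W.toSubmodule.map (simpleSub m n).toSubmodule.subtype)
        (Submodule.map_subtype_le _ _) (by
          rintro g _ ⟨v, hv, rfl⟩
          exact ⟨simpleRep m n g v, W.apply_mem_toSubmodule g hv, rfl⟩)
        (Submodule.mem_map_of_mem hw) (fun h => hw0 (Subtype.ext h))
      apply Subrepresentation.toSubmodule_injective
      refine eq_top_iff.mpr fun v _ => ?_
      obtain ⟨u, hu, he⟩ := hle v.2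
      rwa [← Subtype.ext he]

/-- The entries of the inverse of a matrix of determinant one are polynomials in its entries. -/
theorem exists_polynomial_inv (i k : Fin 3) : ∃ p : MvPolynomial (Fin 3 × Fin 3) ℂ,
    ∀ g : SL3, (g⁻¹).1 i k = eval (fun x => g.1 x.1 x.2) p := by
  refine ⟨(Matrix.of fun a b => (X (a, b) : MvPolynomial (Fin 3 × Fin 3) ℂ)).adjugate i k,
    fun g => ?_⟩
  change g.1.adjugate i k = _
  have h := congrFun (congrFun ((eval fun x : Fin 3 × Fin 3 => g.1 x.1 x.2).map_adjugate
    (Matrix.of fun a b => (X (a, b) : MvPolynomial (Fin 3 × Fin 3) ℂ))) i) k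
  refine Eq.trans ?_ h.symm
  congr 2
  ext a b
  simp

/-- Matrix coefficients of the action on `Sym (E ⊕ E*)` are polynomial functions: they come from
the action of the generic matrix. -/
theorem exists_polynomial_symAct (F : SymPoly) (φ : SymPoly →ₗ[ℂ] ℂ) :
    ∃ p : MvPolynomial (Fin 3 × Fin 3) ℂ,
      ∀ g : SL3, φ (symAct g F) = eval (fun x => g.1 x.1 x.2) p := by
  choose q hq using exists_polynomial_inv
  let gen : SymPoly →+* MvPolynomial (Fin 3 ⊕ Fin 3) (MvPolynomial (Fin 3 × Fin 3) ℂ) :=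
    eval₂Hom (C.comp C) (Sum.elim
      (fun k => ∑ i, C (X (i, k)) * X (Sum.inl i)) (fun k => ∑ i, C (q k i) * X (Sum.inr i)))
  have hgen : ∀ g : SL3, (map (eval fun x : Fin 3 × Fin 3 => g.1 x.1 x.2)).comp gen =
      (symAct g : SymPoly →+* SymPoly) := by
    intro g
    apply MvPolynomial.ringHom_ext
    · intro a
      simp [gen]
    · rintro (k | k)
      · simp [gen, symAct_inl]
      · simp [gen, symAct_inr, hq]
  refine ⟨∑ d ∈ (gen F).support, coeff d (gen F) * C (φ (monomial d 1)), fun g => ?_⟩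
  have h1 : symAct g F = map (eval fun x : Fin 3 × Fin 3 => g.1 x.1 x.2) (gen F) :=
    (RingHom.congr_fun (hgen g) F).symm
  rw [h1]
  conv_lhs => rw [(gen F).as_sum]
  simp only [map_sum, map_mul, map_monomial, eval_C]
  refine Finset.sum_congr rfl fun d _ => ?_
  rw [← smul_eq_mul, ← map_smul, smul_monomial, smul_eq_mul, mul_one]

theorem symAct_hwVector_of_upper {b : SL3} (hb : ∀ i k : Fin 3, k < i → b.1 i k = 0) (m n : ℕ) :
    symAct b (hwVector m n) = (b.1 0 0 ^ m * (b.1 0 0 * b.1 1 1) ^ n) • hwVector m n := by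
  have h10 := hb 1 0 (by decide)
  have h20 := hb 2 0 (by decide)
  have h21 := hb 2 1 (by decide)
  have hinv : (b⁻¹).1 = b.1.adjugate := rfl
  rw [hwVector, map_mul, map_pow, map_pow, symAct_inl, symAct_inr, hinv, Matrix.adjugate_fin_three]
  simp only [Fin.sum_univ_three, h10, h20, h21]
  simp [mul_pow, smul_eq_C_mul]
  ring

theorem simpleRep_isSimpleOfHighestWeight (m n : ℕ) :
    IsSimpleOfHighestWeight (simpleRep m n) m n where
  finiteDimensional := inferInstance
  algebraic v φ := by
    obtain ⟨ψ, hψ⟩ := LinearMap.exists_extend φ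
    obtain ⟨p, hp⟩ := exists_polynomial_symAct v.1 ψ
    refine ⟨p, fun g => ?_⟩
    rw [← hp, ← hψ]
    rfl
  irreducible := simpleRep_isIrreducible m n
  highestWeight := ⟨⟨hwVector m n, hwVector_mem m n⟩,
    fun h => hwVector_ne_zero m n (congrArg Subtype.val h),
    fun _ hb => Subtype.ext (symAct_hwVector_of_upper hb m n)⟩

/-! ### Branching multiplicities as numbers of monomials -/

/-- The eigenvalue of `diag(z, 1, z⁻¹)` on the monomial of exponent `d`. -/
def torusChar (z : ℂ) (d : Fin 3 ⊕ Fin 3 →₀ ℕ) : ℂ := ∏ i, torusWeight ![z, 1, z⁻¹] i ^ d i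

theorem torusWeight_pow (z : ℂ) (p : ℕ) (i : Fin 3 ⊕ Fin 3) :
    torusWeight ![z ^ p, 1, (z ^ p)⁻¹] i = torusWeight ![z, 1, z⁻¹] i ^ p := by
  rcases i with i | i <;> fin_cases i <;> simp [torusWeight]

theorem torusWeight_inv (z : ℂ) (i : Fin 3 ⊕ Fin 3) :
    torusWeight ![z⁻¹, 1, z⁻¹⁻¹] i = (torusWeight ![z, 1, z⁻¹] i)⁻¹ := by
  rcases i with i | i <;> fin_cases i <;> simp [torusWeight]

theorem torusChar_pow (z : ℂ) (p : ℕ) (d : Fin 3 ⊕ Fin 3 →₀ ℕ) :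
    torusChar (z ^ p) d = torusChar z d ^ p := by
  simp only [torusChar, torusWeight_pow, ← Finset.prod_pow, ← pow_mul, mul_comm]

theorem torusChar_inv (z : ℂ) (d : Fin 3 ⊕ Fin 3 →₀ ℕ) :
    torusChar z⁻¹ d = (torusChar z d)⁻¹ := by
  simp only [torusChar, torusWeight_inv, ← Finset.prod_inv_distrib, inv_pow]

theorem torusChar_one (d : Fin 3 ⊕ Fin 3 →₀ ℕ) : torusChar 1 d = 1 := by
  refine Finset.prod_eq_one fun i _ => ?_
  rcases i with i | i <;> fin_cases i <;> simp [torusWeight]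

theorem symAct_incidence (g : SL3) : symAct g incidence = incidence := by
  have h1 : g.1 * (g⁻¹).1 = 1 := by
    rw [← Matrix.SpecialLinearGroup.coe_mul, mul_inv_cancel, Matrix.SpecialLinearGroup.coe_one]
  have h2 : ∀ i l, ∑ k, g.1 i k * (g⁻¹).1 k l = if i = l then 1 else 0 := fun i l => by
    rw [← Matrix.mul_apply, h1, Matrix.one_apply]
  calc symAct g incidence
      = ∑ k, ∑ i, ∑ l, C (g.1 i k * (g⁻¹).1 k l) * (X (Sum.inl i) * X (Sum.inr l)) := by
        simp only [incidence, map_sum, map_mul, symAct_inl, symAct_inr, Finset.sum_mul_sum]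
        refine Finset.sum_congr rfl fun k _ => Finset.sum_congr rfl fun i _ =>
          Finset.sum_congr rfl fun l _ => by ring
    _ = ∑ i, ∑ l, C (∑ k, g.1 i k * (g⁻¹).1 k l) * (X (Sum.inl i) * X (Sum.inr l)) := by
        rw [Finset.sum_comm]
        refine Finset.sum_congr rfl fun i _ => ?_
        rw [Finset.sum_comm]
        simp only [map_sum, Finset.sum_mul]
    _ = incidence := by
        simp only [h2, incidence]
        refine Finset.sum_congr rfl fun i _ => ?_
        rw [Finset.sum_eq_single i]
        · simp
        · intro l _ hl
          simp [hl.symm]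
        · simp

/-- The exponents of the monomials of bidegree `e` with eigenvalue `μ`. -/
def charSet (z : ℂ) (e : Fin 2 →₀ ℕ) (μ : ℂ) : Set (Fin 3 ⊕ Fin 3 →₀ ℕ) :=
  {d | Finsupp.weight bideg d = e ∧ torusChar z d = μ}

/-- The exponents of the monomials with eigenvalue `μ` whose product with the incidence form has
bidegree `e`. -/
def lowerCharSet (z : ℂ) (e : Fin 2 →₀ ℕ) (μ : ℂ) : Set (Fin 3 ⊕ Fin 3 →₀ ℕ) :=
  {d | oneOne + Finsupp.weight bideg d = e ∧ torusChar z d = μ}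

/-- The exponents of the monomials whose product with the incidence form has bidegree `e`. -/
def lowerBidegSet (e : Fin 2 →₀ ℕ) : Finset (Fin 3 ⊕ Fin 3 →₀ ℕ) :=
  if oneOne ≤ e then bidegSet (e - oneOne) else ∅

theorem mem_lowerBidegSet {e : Fin 2 →₀ ℕ} {d : Fin 3 ⊕ Fin 3 →₀ ℕ} :
    d ∈ lowerBidegSet e ↔ oneOne + Finsupp.weight bideg d = e := by
  rw [lowerBidegSet]
  split_ifs with h
  · rw [mem_bidegSet, eq_comm, tsub_eq_iff_eq_add_of_le h, add_comm, eq_comm]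
  · exact iff_of_false (Finset.notMem_empty _) fun he => h (he ▸ le_self_add)

open Classical in
theorem charSet_eq (z : ℂ) (e : Fin 2 →₀ ℕ) (μ : ℂ) :
    charSet z e μ = ((bidegSet e).filter fun d => torusChar z d = μ : Finset _) := by
  ext d
  simp [charSet, mem_bidegSet]

open Classical in
theorem lowerCharSet_eq (z : ℂ) (e : Fin 2 →₀ ℕ) (μ : ℂ) :
    lowerCharSet z e μ = ((lowerBidegSet e).filter fun d => torusChar z d = μ : Finset _) := by
  ext d
  simp [lowerCharSet, mem_lowerBidegSet]

theorem finrank_restrictSupport (s : Set (Fin 3 ⊕ Fin 3 →₀ ℕ)) :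
    Module.finrank ℂ (restrictSupport ℂ s) = s.ncard :=
  Module.finrank_eq_nat_card_basis (basisRestrictSupport ℂ s)

theorem symAct_eq_smul_iff {g : SL3} {z : ℂ} (hg : g.1 = Matrix.diagonal ![z, 1, z⁻¹])
    (F : SymPoly) (μ : ℂ) :
    symAct g F = μ • F ↔ ∀ d, coeff d F ≠ 0 → torusChar z d = μ := by
  rw [MvPolynomial.ext_iff]
  refine forall_congr' fun d => ?_
  rw [coeff_symAct_diagonal hg, coeff_smul, smul_eq_mul]
  change torusChar z d * _ = _ ↔ _
  by_cases h : coeff d F = 0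
  · simp [h]
  · simp [h]

theorem mem_restrictSupport_charSet {g : SL3} {z : ℂ} (hg : g.1 = Matrix.diagonal ![z, 1, z⁻¹])
    {e : Fin 2 →₀ ℕ} {μ : ℂ} {F : SymPoly} :
    F ∈ restrictSupport ℂ (charSet z e μ) ↔ F ∈ biPoly e ∧ symAct g F = μ • F := by
  rw [symAct_eq_smul_iff hg, mem_restrictSupport_iff]
  constructor
  · intro h
    exact ⟨fun d hd => (h (MvPolynomial.mem_support_iff.mpr hd)).1,
      fun d hd => (h (MvPolynomial.mem_support_iff.mpr hd)).2⟩
  · rintro ⟨h1, h2⟩ d hd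
    have hd' := MvPolynomial.mem_support_iff.mp hd
    exact ⟨h1 hd', h2 d hd'⟩

theorem mem_restrictSupport_lowerCharSet {g : SL3} {z : ℂ}
    (hg : g.1 = Matrix.diagonal ![z, 1, z⁻¹]) {e : Fin 2 →₀ ℕ} {μ : ℂ} {h : SymPoly} :
    h ∈ restrictSupport ℂ (lowerCharSet z e μ) ↔
      incidence * h ∈ biPoly e ∧ symAct g h = μ • h := by
  rw [symAct_eq_smul_iff hg, mem_restrictSupport_iff]
  constructor
  · intro hh
    have hw : ∀ d, coeff d h ≠ 0 → oneOne + Finsupp.weight bideg d = e :=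
      fun d hd => (hh (MvPolynomial.mem_support_iff.mpr hd)).1
    refine ⟨?_, fun d hd => (hh (MvPolynomial.mem_support_iff.mpr hd)).2⟩
    rcases eq_or_ne h 0 with rfl | h0
    · rw [mul_zero]
      exact Submodule.zero_mem _
    · obtain ⟨d, hd⟩ := MvPolynomial.ne_zero_iff.mp h0
      rw [← hw d hd]
      refine IsWeightedHomogeneous.mul incidence_mem_biPoly fun d' hd' => ?_
      exact add_left_cancel ((hw d' hd').trans (hw d hd).symm)
  · rintro ⟨h1, h2⟩ d hd
    have hd' := MvPolynomial.mem_support_iff.mp hd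
    exact ⟨weight_of_incidence_mul_mem h1 hd', h2 d hd'⟩

/-- Since `Sym^m E ⊗ Sym^n E*` is the direct sum of `V(m, n)` and the multiples of the invariant
incidence form, the eigenspaces of a diagonal element on `V(m, n)` are counted by monomials. -/
theorem finrank_eigenspace_add {g : SL3} {z : ℂ} (hg : g.1 = Matrix.diagonal ![z, 1, z⁻¹])
    (m n : ℕ) (μ : ℂ) :
    Module.finrank ℂ (Module.End.eigenspace (simpleRep m n g) μ) +
      (lowerCharSet z (bi m n) μ).ncard = (charSet z (bi m n) μ).ncard := by
  classical
  let E : Submodule ℂ SymPoly :=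
    (simpleSub m n).toSubmodule ⊓ Module.End.eigenspace (symRep g) μ
  have hEv : ∀ v : SymPoly, v ∈ E ↔ v ∈ (simpleSub m n).toSubmodule ∧ symAct g v = μ • v := by
    intro v
    rw [Submodule.mem_inf, Module.End.mem_eigenspace_iff]
    rfl
  have hrank : Module.finrank ℂ (Module.End.eigenspace (simpleRep m n g) μ) =
      Module.finrank ℂ E :=
    LinearEquiv.finrank_eq
      { toFun := fun v => ⟨v.1.1, v.1.2, Module.End.mem_eigenspace_iff.mpr
          (congrArg Subtype.val (Module.End.mem_eigenspace_iff.mp v.2))⟩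
        map_add' := fun _ _ => rfl
        map_smul' := fun _ _ => rfl
        invFun := fun v => ⟨⟨v.1, v.2.1⟩, Module.End.mem_eigenspace_iff.mpr
          (Subtype.ext (Module.End.mem_eigenspace_iff.mp v.2.2))⟩
        left_inv := fun _ => rfl
        right_inv := fun _ => rfl }
  have : FiniteDimensional ℂ E := Submodule.finiteDimensional_inf_left _ _
  have : Module.Finite ℂ (restrictSupport ℂ (lowerCharSet z (bi m n) μ)) :=
    finite_restrictSupport (by rw [lowerCharSet_eq]; exact Finset.finite_toSet _)
  let f : (E × restrictSupport ℂ (lowerCharSet z (bi m n) μ)) →ₗ[ℂ] SymPoly :=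
    E.subtype.coprod
      (LinearMap.mulLeft ℂ incidence ∘ₗ Submodule.subtype _)
  have hf : ∀ x, f x = x.1.1 + incidence * x.2.1 := fun x => rfl
  have hmem : ∀ x, f x ∈ restrictSupport ℂ (charSet z (bi m n) μ) := by
    rintro ⟨⟨v, hv⟩, ⟨h, hh⟩⟩
    rw [mem_restrictSupport_charSet hg, hf]
    rw [mem_restrictSupport_lowerCharSet hg] at hh
    refine ⟨Submodule.add_mem _ (simpleSub_le_biPoly m n hv.1) hh.1, ?_⟩
    rw [map_add, map_mul, symAct_incidence, hh.2, ((hEv v).mp hv).2, smul_add, mul_smul_comm]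
  have hbij : Function.Bijective (f.codRestrict _ hmem) := by
    constructor
    · rw [← LinearMap.ker_eq_bot, LinearMap.ker_eq_bot']
      rintro ⟨⟨v, hv⟩, ⟨h, hh⟩⟩ hx
      have hx' : v + incidence * h = 0 := congrArg Subtype.val hx
      have hv0 : v = 0 := eq_zero_of_incidence_dvd hv.1
        ⟨-h, by rw [eq_neg_of_add_eq_zero_left hx', mul_neg]⟩
      rw [hv0, zero_add] at hx'
      have hh0 := (mul_eq_zero.mp hx').resolve_left incidence_prime.ne_zero
      ext1
      · exact Subtype.ext hv0
      · exact Subtype.ext hh0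
    · rintro ⟨F, hF⟩
      obtain ⟨hF1, hF2⟩ := (mem_restrictSupport_charSet hg).mp hF
      obtain ⟨v, hv, h, hh⟩ := exists_incidence_dvd_sub hF1
      have hFv : F = v + incidence * h := by rw [← hh]; ring
      -- the components of an eigenvector are eigenvectors because the sum is direct
      have hgv : symAct g v - μ • v = incidence * (μ • h - symAct g h) := by
        rw [hFv, map_add, map_mul, symAct_incidence, smul_add, ← mul_smul_comm] at hF2
        linear_combination hF2
      have h0 : symAct g v - μ • v = 0 := eq_zero_of_incidence_dvd
        (Submodule.sub_mem _ ((simpleSub m n).apply_mem_toSubmodule g hv)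
          (Submodule.smul_mem _ _ hv)) ⟨_, hgv⟩
      rw [h0] at hgv
      have h1 := (mul_eq_zero.mp hgv.symm).resolve_left incidence_prime.ne_zero
      have hlow : h ∈ restrictSupport ℂ (lowerCharSet z (bi m n) μ) := by
        rw [mem_restrictSupport_lowerCharSet hg]
        refine ⟨?_, (sub_eq_zero.mp h1).symm⟩
        rw [← hh]
        exact Submodule.sub_mem _ hF1 (simpleSub_le_biPoly m n hv)
      refine ⟨(⟨v, (hEv v).mpr ⟨hv, sub_eq_zero.mp h0⟩⟩, ⟨h, hlow⟩), Subtype.ext ?_⟩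
      exact hFv.symm
  rw [hrank, ← finrank_restrictSupport, ← finrank_restrictSupport, ← Module.finrank_prod]
  exact (LinearEquiv.ofBijective _ hbij).finrank_eq

open Classical in
theorem branchMult_add (j : ℕ) [NeZero j] (i : Fin j) (m n : ℕ) :
    branchMult j i m n +
      ((lowerBidegSet (bi m n)).filter fun d => torusChar (zeta j) d = zeta j ^ i.val).card =
      ((bidegSet (bi m n)).filter fun d => torusChar (zeta j) d = zeta j ^ i.val).card := by
  have hg : (gammaHom j (Multiplicative.ofAdd 1)).1 =
      Matrix.diagonal ![zeta j, 1, (zeta j)⁻¹] := by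
    change Matrix.diagonal _ = _
    rw [toAdd_ofAdd, zeta_pow_one_val]
  have h := finrank_eigenspace_add hg m n (zeta j ^ i.val)
  rw [lowerCharSet_eq, charSet_eq, Set.ncard_coe_finset, Set.ncard_coe_finset] at h
  rw [← h, branchMult, multiplicity_irr]
  rfl

/-! ### Generating series -/

/-- The geometric series `∑ k, c^k * X s ^ k`. -/
def geomSeries (s : Fin 2) (c : ℂ) : MvPowerSeries (Fin 2) ℂ :=
  fun e => if e = Finsupp.single s (e s) then c ^ e s else 0

theorem one_sub_mul_geomSeries (s : Fin 2) (c : ℂ) :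
    (1 - MvPowerSeries.X s * MvPowerSeries.C c) * geomSeries s c = 1 := by
  classical
  have hX : (MvPowerSeries.X s * MvPowerSeries.C c : MvPowerSeries (Fin 2) ℂ) =
      MvPowerSeries.monomial (Finsupp.single s 1) c := by
    rw [MvPowerSeries.X, ← MvPowerSeries.monomial_zero_eq_C_apply,
      MvPowerSeries.monomial_mul_monomial, add_zero, one_mul]
  have hcoeff : ∀ e, MvPowerSeries.coeff e (geomSeries s c) =
      if e = Finsupp.single s (e s) then c ^ e s else 0 := fun _ => rfl
  ext e
  rw [hX, sub_mul, one_mul, map_sub, MvPowerSeries.coeff_monomial_mul, MvPowerSeries.coeff_one]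
  split_ifs with h1 h2 h2
  · subst h2
    have := h1 s
    simp at this
  · obtain ⟨e', rfl⟩ := exists_add_of_le h1
    rw [add_tsub_cancel_left, hcoeff, hcoeff, Finsupp.add_apply, Finsupp.single_eq_same,
      Finsupp.single_add]
    simp only [add_right_inj]
    split_ifs
    · rw [pow_add, pow_one, sub_self]
    · rw [mul_zero, sub_zero]
  · subst h2
    simp [hcoeff]
  · have hs : e s = 0 := by
      by_contra hne
      exact h1 (Finsupp.single_le_iff.mpr (Nat.one_le_iff_ne_zero.mpr hne))
    rw [hcoeff, hs, Finsupp.single_zero, if_neg h2, sub_zero]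

/-- The variable of the generating series in which a polynomial variable is counted. -/
def seriesVar : Fin 3 ⊕ Fin 3 → Fin 2 := Sum.elim (fun _ => 0) (fun _ => 1)

theorem bideg_eq_single (i : Fin 3 ⊕ Fin 3) : bideg i = Finsupp.single (seriesVar i) 1 := by
  rcases i with i | i <;> rfl

/-- The generating series of the characters of `Sym^m E ⊗ Sym^n E*` at `diag(z, 1, z⁻¹)`. -/
def symSeries (z : ℂ) : MvPowerSeries (Fin 2) ℂ := fun e => ∑ d ∈ bidegSet e, torusChar z d

theorem prod_geomSeries (z : ℂ) :
    ∏ i, geomSeries (seriesVar i) (torusWeight ![z, 1, z⁻¹] i) = symSeries z := by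
  classical
  ext e
  rw [MvPowerSeries.coeff_prod]
  let emb : (Fin 3 ⊕ Fin 3 →₀ ℕ) → (Fin 3 ⊕ Fin 3 →₀ (Fin 2 →₀ ℕ)) := fun d =>
    Finsupp.equivFunOnFinite.symm fun i => Finsupp.single (seriesVar i) (d i)
  have hemb : ∀ d i, emb d i = Finsupp.single (seriesVar i) (d i) := fun _ _ => rfl
  have hsum : ∀ d, ∑ i, emb d i = Finsupp.weight bideg d := by
    intro d
    rw [Finsupp.weight_eq_sum]
    refine Finset.sum_congr rfl fun i _ => ?_
    rw [hemb, bideg_eq_single, Finsupp.smul_single, smul_eq_mul, mul_one]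
  refine (Finset.sum_of_injOn emb ?_ ?_ ?_ ?_).symm
  · intro d _ d' _ h
    ext i
    have := DFunLike.congr_fun (DFunLike.congr_fun h i) (seriesVar i)
    simpa [hemb] using this
  · intro d hd
    rw [Finset.mem_coe, Finset.mem_finsuppAntidiag, hsum]
    exact ⟨mem_bidegSet.mp hd, Finset.subset_univ _⟩
  · intro l hl hnot
    rw [Finset.mem_finsuppAntidiag] at hl
    by_contra hne
    rw [← Ne, Finset.prod_ne_zero_iff] at hne
    have hsingle : ∀ i, l i = Finsupp.single (seriesVar i) (l i (seriesVar i)) := by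
      intro i
      by_contra hi
      exact hne i (Finset.mem_univ i) (if_neg hi)
    have hl' : emb (Finsupp.equivFunOnFinite.symm fun i => l i (seriesVar i)) = l := by
      ext1 i
      rw [hemb]
      exact (hsingle i).symm
    refine hnot ⟨_, ?_, hl'⟩
    rw [Finset.mem_coe, mem_bidegSet, ← hsum, hl']
    exact hl.1
  · intro d _
    refine Finset.prod_congr rfl fun i _ => ?_
    rw [hemb]
    change _ = if _ then _ else _
    rw [Finsupp.single_eq_same, if_pos rfl]

theorem denom_eq_prod (z : ℂ) : denom z = ∏ i, (1 - MvPowerSeries.X (seriesVar i) *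
    MvPowerSeries.C (torusWeight ![z, 1, z⁻¹] i)) := by
  rw [Fintype.prod_sum_type, Fin.prod_univ_three, Fin.prod_univ_three]
  simp [denom, seriesVar, torusWeight]
  ring

theorem denom_inv (z : ℂ) : (denom z)⁻¹ = symSeries z⁻¹ := by
  have hsymm : denom z = denom z⁻¹ := by
    simp only [denom, inv_inv]
    ring
  have h1 : symSeries z⁻¹ * denom z = 1 := by
    rw [hsymm, denom_eq_prod, ← prod_geomSeries, ← Finset.prod_mul_distrib]
    exact Finset.prod_eq_one fun i _ => by rw [mul_comm, one_sub_mul_geomSeries]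
  have h0 : MvPowerSeries.constantCoeff (denom z) ≠ 0 := by simp [denom]
  exact (MvPowerSeries.inv_eq_iff_mul_eq_one h0).mpr h1

theorem coeff_one_sub_mul_symSeries (z : ℂ) (e : Fin 2 →₀ ℕ) :
    MvPowerSeries.coeff e ((1 - MvPowerSeries.X 0 * MvPowerSeries.X 1) * symSeries z) =
      ∑ d ∈ bidegSet e, torusChar z d - ∑ d ∈ lowerBidegSet e, torusChar z d := by
  have hX : (MvPowerSeries.X 0 * MvPowerSeries.X 1 : MvPowerSeries (Fin 2) ℂ) =
      MvPowerSeries.monomial oneOne 1 := by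
    rw [MvPowerSeries.X, MvPowerSeries.X, MvPowerSeries.monomial_mul_monomial, one_mul]
    rfl
  rw [hX, sub_mul, one_mul, map_sub, MvPowerSeries.coeff_monomial_mul, lowerBidegSet]
  congr 1
  split_ifs
  · rw [one_mul]
    rfl
  · rfl

open Classical in
/-- Averaging over `ℤ/jℤ` extracts the monomials on which it acts through `γ_i`. -/
theorem sum_zeta_mul_torusChar (j : ℕ) [NeZero j] (i : Fin j) (d : Fin 3 ⊕ Fin 3 →₀ ℕ) :
    ∑ p ∈ Finset.range j, zeta j ^ (i.val * p) * torusChar (zeta j ^ p)⁻¹ d =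
      if torusChar (zeta j) d = zeta j ^ i.val then (j : ℂ) else 0 := by
  set ω := zeta j ^ i.val * (torusChar (zeta j) d)⁻¹ with hω
  have hχ : torusChar (zeta j) d ^ j = 1 := by
    rw [← torusChar_pow, zeta_pow_self, torusChar_one]
  have hχ0 : torusChar (zeta j) d ≠ 0 := fun h => by
    rw [h, zero_pow (NeZero.ne j)] at hχ
    exact zero_ne_one hχ
  have hωj : ω ^ j = 1 := by
    rw [hω, mul_pow, inv_pow, hχ, ← pow_mul, mul_comm i.val, pow_mul, zeta_pow_self, one_pow,
      inv_one, mul_one]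
  have hterm : ∀ p, zeta j ^ (i.val * p) * torusChar (zeta j ^ p)⁻¹ d = ω ^ p := fun p => by
    rw [torusChar_inv, torusChar_pow, hω, mul_pow, pow_mul, inv_pow]
  have hω1 : torusChar (zeta j) d = zeta j ^ i.val ↔ ω = 1 := by
    rw [hω, mul_inv_eq_one₀ hχ0, eq_comm]
  simp only [hterm, hω1]
  split_ifs with h
  · simp [h]
  · have h1 := mul_neg_geom_sum ω j
    rw [hωj, sub_self] at h1
    exact (mul_eq_zero.mp h1).resolve_left (sub_ne_zero.mpr (Ne.symm h))

theorem branchSeries_eq (j : ℕ) [NeZero j] (i : Fin j) : branchSeries j i =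
      MvPowerSeries.C (1 / (j : ℂ)) * ∑ p ∈ Finset.range j,
        MvPowerSeries.C (zeta j ^ (i.val * p)) *
          (1 - MvPowerSeries.X 0 * MvPowerSeries.X 1) * (denom (zeta j ^ p))⁻¹ := by
  classical
  have hj : (j : ℂ) ≠ 0 := Nat.cast_ne_zero.mpr (NeZero.ne j)
  have havg : ∀ s : Finset (Fin 3 ⊕ Fin 3 →₀ ℕ),
      ∑ p ∈ Finset.range j, zeta j ^ (i.val * p) * ∑ d ∈ s, torusChar (zeta j ^ p)⁻¹ d =
        (j : ℂ) * (s.filter fun d => torusChar (zeta j) d = zeta j ^ i.val).card := by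
    intro s
    simp only [Finset.mul_sum]
    rw [Finset.sum_comm]
    simp only [sum_zeta_mul_torusChar]
    rw [← Finset.sum_filter, Finset.sum_const, nsmul_eq_mul, mul_comm]
  ext e
  have he : bi (e 0) (e 1) = e := by
    ext k
    fin_cases k <;> simp [bi]
  have hb := branchMult_add j i (e 0) (e 1)
  rw [he] at hb
  have hb' := congrArg (Nat.cast : ℕ → ℂ) hb
  rw [Nat.cast_add] at hb'
  change (branchMult j i (e 0) (e 1) : ℂ) = _
  rw [MvPowerSeries.coeff_C_mul, map_sum]
  have hterm : ∀ p, MvPowerSeries.coeff e (MvPowerSeries.C (zeta j ^ (i.val * p)) *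
      (1 - MvPowerSeries.X 0 * MvPowerSeries.X 1) * (denom (zeta j ^ p))⁻¹) =
      zeta j ^ (i.val * p) * ∑ d ∈ bidegSet e, torusChar (zeta j ^ p)⁻¹ d -
        zeta j ^ (i.val * p) * ∑ d ∈ lowerBidegSet e, torusChar (zeta j ^ p)⁻¹ d := fun p => by
    rw [mul_assoc, MvPowerSeries.coeff_C_mul, denom_inv, coeff_one_sub_mul_symSeries, mul_sub]
  simp only [hterm, Finset.sum_sub_distrib, havg]
  rw [← hb']
  field_simp
  ring

end McKayA1

end

open McKayA1 in
theorem mainTheorem7 (j : ℕ) [NeZero j] :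
    -- the modules `V(m, n)` are the simple modules of highest weight `m ϖ₁ + n ϖ₂`
    (∀ m n : ℕ, IsSimpleOfHighestWeight (simpleRep m n) m n) ∧
    -- `γ` is an embedding, and the `γ_i` are the irreducible representations of `ℤ/jℤ`
    Function.Injective (gammaHom j) ∧
    (∀ i : Fin j, (irr j i).IsIrreducible) ∧
    (∀ i k : Fin j, Nonempty ((irr j i).Equiv (irr j k)) → i = k) ∧
    (∀ (W : Type*) [AddCommGroup W] [Module ℂ W] [FiniteDimensional ℂ W]
      (σ : Representation ℂ (Gam j) W), σ.IsIrreducible →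
      ∃ i : Fin j, Nonempty (σ.Equiv (irr j i))) ∧
    -- the formula for the series of multiplicities
    (∀ i : Fin j, branchSeries j i =
      MvPowerSeries.C (1 / (j : ℂ)) * ∑ p ∈ Finset.range j,
        MvPowerSeries.C (zeta j ^ (i.val * p)) *
          (1 - MvPowerSeries.X 0 * MvPowerSeries.X 1) * (denom (zeta j ^ p))⁻¹) ∧
    -- the matrix `A⁽¹⁾`
    (j = 2 → ∀ i k : Fin j, mcKayMatrix j i k = if i = k then 1 else 2) ∧
    (3 ≤ j → ∀ i k : Fin j,
      mcKayMatrix j i k = if i = k ∨ i = k + 1 ∨ k = i + 1 then 1 else 0) ∧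
    -- the decomposition of the generalized Cartan matrix
    (Even j →
      IsOrthogonalPartition (cartan j) 2 (partsEven j) ∧
      (∀ a, ∀ k ∈ partsEven j a, ∀ l ∈ partsEven j a,
        Commute (reflection (cartan j) k) (reflection (cartan j) l)) ∧
      cartan j = (2 : ℤ) • (1 : Matrix (Fin j) (Fin j) ℤ) -
        ∑ a, reflectionProd (cartan j) (partsEven j a)) ∧
    (Odd j →
      IsOrthogonalPartition (cartan j) 3 (partsOdd j) ∧
      (∀ a, ∀ k ∈ partsOdd j a, ∀ l ∈ partsOdd j a,
        Commute (reflection (cartan j) k) (reflection (cartan j) l)) ∧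
      cartan j = (3 : ℤ) • (1 : Matrix (Fin j) (Fin j) ℤ) -
        ∑ a, reflectionProd (cartan j) (partsOdd j a)) ∧
    -- the number of parts is minimal
    (2 ≤ j → IsLeast {p : ℕ | ∃ S : Fin p → Finset (Fin j),
      IsOrthogonalPartition (cartan j) p S} (if Even j then 2 else 3)) ∧
    -- the graph is a cycle
    (3 ≤ j → cartanGraph (cartan j) = SimpleGraph.cycleGraph j) := by
  refine ⟨simpleRep_isSimpleOfHighestWeight, gammaHom_injective j, irr_isIrreducible j,
    irr_injective j, fun W _ _ _ σ hσ => exists_equiv_irr j σ hσ, branchSeries_eq j,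
    mcKayMatrix_two j, mcKayMatrix_of_three_le j, fun hj => ?_, fun hj => ?_, fun hj => ⟨?_, ?_⟩,
    fun _ => cartanGraph_eq_cycleGraph j⟩
  · have h := isOrthogonalPartition_even j hj
    exact ⟨h, h.commute, h.eq_sub_sum⟩
  · have h := isOrthogonalPartition_odd j hj
    exact ⟨h, h.commute, h.eq_sub_sum⟩
  · split_ifs with he
    · exact ⟨_, isOrthogonalPartition_even j he⟩
    · exact ⟨_, isOrthogonalPartition_odd j (Nat.not_even_iff_odd.mp he)⟩
  · rintro p ⟨S, hS⟩
    exact le_of_isOrthogonalPartition j hj hS
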